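/- Let $k$ be a field of characteristic $0$ and $n\in\mathbb Z$. A formal moduli problem is represented by a finite-dimensional $\mathbb Z$-graded vector space $\mathfrak g$ with an $L_\infty$ structure, i.e. a vector field $Q_{\mathfrak g}$ of degree $1$ on $\mathfrak g[1]$ (a derivation of $\mathcal O(X)=\widehat{\mathrm{Sym}}(\mathfrak g^*[-1])$) which vanishes at the origin and satisfies $Q_{\mathfrak g}^2=0$. Let $X$ be a formal moduli problem with $L_\infty$ algebra $\mathfrak g$, with a strict constant coefficient $n$-shifted symplectic structure, i.e. a graded symmetric linear isomorphism $\omega:\mathfrak g\to\mathfrak g^*[n-2]$, and suppose that the $L_\infty$ structure is given by an action functional: $Q_{\mathfrak g}$ is the Hamiltonian vector field of some $S\in\mathcal O(X)$ of cohomological degree $n+1$ without terms of polynomial degree $0$ and $1$. Let $L_+\hookrightarrow X$ be a regular embedded Lagrangian, i.e. a formal moduli problem with finite-dimensional $L_\infty$ algebra $(\mathfrak l_+,Q_{\mathfrak l_+})$ and an injective strict $L_\infty$ map $\mathfrak l_+\to\mathfrak g$ such that $\omega$ vanishes on $\mathfrak l_+$, and fix a graded complement $\mathfrak l_-$ of $\mathfrak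 l_+$ in $\mathfrak g$ on which $\omega$ vanishes as well. Then $\omega$ identifies $\mathfrak l_-$ with $\mathfrak l_+^*[n-2]$, and $\mathfrak g\cong\mathfrak l_+\oplus\mathfrak l_+^*[n-2]$ induces $$\Phi:\mathcal O(X)\;\cong\;\widehat{\mathrm{Sym}}(\mathfrak l_+^*[-1])\,\widehat\otimes\,\widehat{\mathrm{Sym}}(\mathfrak l_+[1-n])=\prod_{j\ge 0}\Gamma\bigl(L_+,\mathrm{Sym}^j(\mathbb T_{L_+}[-n])\bigr).$$ Write $\Phi(S)=\sum_{j\ge0}S_j$ with $S_j\in\Gamma(L_+,\mathrm{Sym}^j(\mathbb T_{L_+}[-n]))$, of cohomological degree $n+1$. Then: 1. $S_0=0$; 2. $S_1=Q_{\mathfrak l_+}$, the cohomological vector field defining the $L_\infty$ structure on $\mathfrak l_+$; thus $\Phi(S)=Q_{\mathfrak l_+}+\bar\Pi$ with $\bar\Pi=\sum_{j\ge2}S_j$; 3. $\bar\Pi=\{S_j\}_{j\ge2}$ is an $(n-1)$-shifted homotopy Poisson structure on $L_+$, i.e. $[Q_{\mathfrak l_+}+\bar\Pi,\,Q_{\mathfrak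 l_+}+\bar\Pi]=0$ for the Schouten bracket; 4. for every $T\in\mathcal O(X)$ of cohomological degree $n+1$, the classical master equation $\{T,T\}_\omega=0$ is equivalent to $[\Phi(T),\Phi(T)]=0$; in particular the classical master equation for $S$ is equivalent to the equation in 3. -/

import Mathlib

open scoped Polynomial

universe u v w x

noncomputable section

/-! ### Finite-dimensional `ℤ`-graded vector spaces -/

/-- A finite-dimensional `ℤ`-graded vector space over `k`. -/
structure GrSpace (k : Type u) [Field k] where
  carrier : Type v
  [addCommGroup : AddCommGroup carrier]
  [module : Module k carrier]
  [finiteDimensional : FiniteDimensional k carrier]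
  /-- the homogeneous components -/
  gr : ℤ → Submodule k carrier
  internal : DirectSum.IsInternal gr

namespace GrSpace

instance {k : Type u} [Field k] : CoeSort (GrSpace.{u, v} k) (Type v) := ⟨GrSpace.carrier⟩

attribute [instance] GrSpace.addCommGroup GrSpace.module GrSpace.finiteDimensional

/-- The sign `(-1) ^ m` as an element of `k`. -/
def ksign (k : Type u) [Field k] (m : ℤ) : k := ((m.negOnePow : ℤ) : k)

lemma ksign_of_even {k : Type u} [Field k] {m : ℤ} (h : Even m) : ksign k m = 1 := by
  simp [ksign, Int.negOnePow_even m h]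

lemma ksign_of_odd {k : Type u} [Field k] {m : ℤ} (h : Odd m) : ksign k m = -1 := by
  simp [ksign, Int.negOnePow_odd m h]

variable {k : Type u} [Field k]

/-- The linear endomorphism acting on the component of degree `d` as the scalar `c d`. -/
def diag (A : GrSpace.{u, v} k) (c : ℤ → k) : A →ₗ[k] A :=
  (DirectSum.toModule k ℤ A fun d => c d • (A.gr d).subtype) ∘ₗ
    (LinearEquiv.ofBijective (DirectSum.coeLinearMap A.gr) A.internal).symm.toLinearMap

lemma diag_of_mem (A : GrSpace.{u, v} k) (c : ℤ → k) {d : ℤ} {a : A} (ha : a ∈ A.gr d) :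
    A.diag c a = c d • a := by
  have : (LinearEquiv.ofBijective (DirectSum.coeLinearMap A.gr) A.internal).symm a
      = DirectSum.lof k ℤ (fun d => A.gr d) d ⟨a, ha⟩ := by
    rw [LinearEquiv.symm_apply_eq]
    exact (DirectSum.coeLinearMap_lof (A := A.gr) d ⟨a, ha⟩).symm
  rw [diag, LinearMap.comp_apply, LinearEquiv.coe_coe, this, DirectSum.toModule_lof]
  rfl

lemma induction_gr (A : GrSpace.{u, v} k) {p : A → Prop} (a : A)
    (hm : ∀ d, ∀ b ∈ A.gr d, p b) (h0 : p 0) (ha : ∀ b c, p b → p c → p (b + c)) : p a := by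
  have : a ∈ ⨆ d, A.gr d := by
    rw [A.internal.submodule_iSup_eq_top]; trivial
  exact Submodule.iSup_induction A.gr (motive := p) this hm h0 ha

/-- The component of degree `d`. -/
def proj (A : GrSpace.{u, v} k) (d : ℤ) : A →ₗ[k] A := A.diag fun e => if e = d then 1 else 0

lemma proj_of_mem (A : GrSpace.{u, v} k) {d : ℤ} {a : A} (ha : a ∈ A.gr d) (e : ℤ) :
    A.proj e a = if d = e then a else 0 := by
  rw [proj, diag_of_mem A _ ha]; split_ifs <;> simp

lemma proj_mem (A : GrSpace.{u, v} k) (d : ℤ) (a : A) : A.proj d a ∈ A.gr d := by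
  refine A.induction_gr (p := fun a => A.proj d a ∈ A.gr d) a ?_ (by simp) ?_
  · intro e b hb
    rw [A.proj_of_mem hb]
    split_ifs with h
    · exact h ▸ hb
    · exact zero_mem _
  · intro b c hb hc
    rw [map_add]; exact add_mem hb hc

lemma exists_sum_proj (A : GrSpace.{u, v} k) (a : A) :
    ∃ s : Finset ℤ, ∀ t : Finset ℤ, s ⊆ t → a = ∑ d ∈ t, A.proj d a := by
  refine A.induction_gr (p := fun a => ∃ s : Finset ℤ, ∀ t : Finset ℤ, s ⊆ t →
    a = ∑ d ∈ t, A.proj d a) a ?_ ⟨∅, by simp⟩ ?_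
  · intro e b hb
    refine ⟨{e}, fun t ht => ?_⟩
    simp only [A.proj_of_mem hb]
    rw [Finset.sum_ite_eq, if_pos (ht (by simp))]
  · rintro b c ⟨s, hs⟩ ⟨s', hs'⟩
    refine ⟨s ∪ s', fun t ht => ?_⟩
    simp only [map_add, Finset.sum_add_distrib]
    rw [← hs t (Finset.union_subset_left ht), ← hs' t (Finset.union_subset_right ht)]

lemma eq_of_proj_eq (A : GrSpace.{u, v} k) {a b : A} (h : ∀ d, A.proj d a = A.proj d b) :
    a = b := by
  obtain ⟨s, hs⟩ := A.exists_sum_proj a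
  obtain ⟨t, ht⟩ := A.exists_sum_proj b
  rw [hs (s ∪ t) Finset.subset_union_left, ht (s ∪ t) Finset.subset_union_right]
  simp only [h]

lemma mem_gr_of_proj (A : GrSpace.{u, v} k) {d : ℤ} {a : A} (h : ∀ e, e ≠ d → A.proj e a = 0) :
    a ∈ A.gr d := by
  have : a = A.proj d a := by
    refine A.eq_of_proj_eq fun e => ?_
    rw [A.proj_of_mem (A.proj_mem d a)]
    split_ifs with he
    · rw [he]
    · exact h e (Ne.symm he)
  rw [this]; exact A.proj_mem d a

/-- Criterion for a family of subspaces to be a grading, through a family of projections. -/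
lemma isInternal_of_proj {W : Type w} [AddCommGroup W] [Module k W] (g : ℤ → Submodule k W)
    (π : ℤ → W →ₗ[k] W) (hπ : ∀ d e, ∀ a ∈ g d, π e a = if d = e then a else 0)
    (htop : ∀ a, a ∈ ⨆ d, g d) : DirectSum.IsInternal g := by
  refine DirectSum.isInternal_submodule_of_iSupIndep_of_iSup_eq_top ?_
    (eq_top_iff.2 fun a _ => htop a)
  rw [iSupIndep_def]
  intro d
  rw [Submodule.disjoint_def]
  intro a ha ha'
  have h1 : π d a = a := by rw [hπ d d a ha, if_pos rfl]
  have h2 : (⨆ (j) (_ : j ≠ d), g j) ≤ LinearMap.ker (π d) := by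
    refine iSup₂_le fun j hj b hb => ?_
    rw [LinearMap.mem_ker, hπ j d b hb, if_neg hj]
  rw [← h1]; exact h2 ha'

/-- The shift `A[m]`, with `(A[m])^d = A^(d+m)`. -/
@[reducible] def shift (A : GrSpace.{u, v} k) (m : ℤ) : GrSpace.{u, v} k where
  carrier := A
  gr d := A.gr (d + m)
  internal := by
    refine isInternal_of_proj _ (fun d => A.proj (d + m)) (fun d e a ha => ?_) (fun a => ?_)
    · rw [A.proj_of_mem ha]; simp
    · refine A.induction_gr (p := fun a => a ∈ ⨆ d, A.gr (d + m)) a ?_ (zero_mem _)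
        (fun _ _ => add_mem)
      intro d b hb
      refine Submodule.mem_iSup_of_mem (d - m) ?_
      simpa using hb

/-- The linear dual, in which a functional of degree `d` lives on the component of degree `-d`. -/
@[reducible] def dual (A : GrSpace.{u, v} k) : GrSpace.{u, max u v} k where
  carrier := Module.Dual k A
  gr d :=
    { carrier := {φ | ∀ e, e ≠ -d → ∀ a ∈ A.gr e, φ a = 0}
      add_mem' := fun {φ ψ} hφ hψ e he a ha => by simp [hφ e he a ha, hψ e he a ha]
      zero_mem' := fun e he a ha => rfl
      smul_mem' := fun c φ hφ e he a ha => by simp [hφ e he a ha] }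
  internal := by
    refine isInternal_of_proj _ (fun d => (A.proj (-d)).dualMap) (fun d e φ hφ => ?_) (fun φ => ?_)
    · refine LinearMap.ext fun a => ?_
      refine A.induction_gr (p := fun a => ((A.proj (-e)).dualMap φ) a
        = (if d = e then φ else 0 : Module.Dual k A) a) a ?_ (by simp) ?_
      · intro c b hb
        rw [LinearMap.dualMap_apply, A.proj_of_mem hb]
        by_cases hc : c = -d
        · subst hc
          by_cases hde : d = e <;> simp [hde]
        · have := hφ c hc b hb
          by_cases hde : d = e <;> by_cases h2 : c = -e <;> simp [hde, h2, this]
      · intro b c hb hc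
        simp only [map_add, hb, hc]
    · let b := Module.finBasis k A
      choose s hs using fun i => A.exists_sum_proj (b i)
      let t : Finset ℤ := Finset.univ.biUnion s
      have key : φ = ∑ d ∈ t, (A.proj d).dualMap φ := by
        refine b.ext fun i => ?_
        conv_lhs => rw [hs i t (Finset.subset_biUnion_of_mem s (Finset.mem_univ i))]
        simp [LinearMap.sum_apply]
      rw [key]
      refine sum_mem fun d _ => Submodule.mem_iSup_of_mem (-d) ?_
      intro e he a ha
      rw [LinearMap.dualMap_apply, A.proj_of_mem ha, if_neg (by simpa using he), map_zero]

/-- The direct sum of two graded vector spaces. -/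
@[reducible] def prod (A : GrSpace.{u, v} k) (B : GrSpace.{u, w} k) : GrSpace.{u, max v w} k where
  carrier := A × B
  gr d := (A.gr d).prod (B.gr d)
  internal := by
    refine isInternal_of_proj _ (fun d => (A.proj d).prodMap (B.proj d)) (fun d e a ha => ?_)
      (fun a => ?_)
    · rw [LinearMap.prodMap_apply, A.proj_of_mem ha.1, B.proj_of_mem ha.2]
      split_ifs <;> rfl
    · have h1 : ∀ y : A, (y, (0 : B)) ∈ ⨆ d, (A.gr d).prod (B.gr d) := fun y =>
        A.induction_gr (p := fun y => (y, (0 : B)) ∈ ⨆ d, (A.gr d).prod (B.gr d)) y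
          (fun d b hb => Submodule.mem_iSup_of_mem d ⟨hb, zero_mem _⟩) (zero_mem _)
          (fun b c hb hc => by simpa using add_mem hb hc)
      have h2 : ∀ y : B, ((0 : A), y) ∈ ⨆ d, (A.gr d).prod (B.gr d) := fun y =>
        B.induction_gr (p := fun y => ((0 : A), y) ∈ ⨆ d, (A.gr d).prod (B.gr d)) y
          (fun d b hb => Submodule.mem_iSup_of_mem d ⟨zero_mem _, hb⟩) (zero_mem _)
          (fun b c hb hc => by simpa using add_mem hb hc)
      simpa using add_mem (h1 a.1) (h2 a.2)

/-- `v ↦ (-1) ^ (m |v|) v`. -/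
def sgn (A : GrSpace.{u, v} k) (m : ℤ) : A →ₗ[k] A := A.diag fun d => ksign k (m * d)

/-- The projection to the components whose degree has the parity of `ε`. -/
def parity (A : GrSpace.{u, v} k) (ε : ℤ) : A →ₗ[k] A :=
  open Classical in A.diag fun d => if Even (d + ε) then 1 else 0

end GrSpace

open GrSpace

/-- A degree-preserving linear map. -/
structure GrHom {k : Type u} [Field k] (A : GrSpace.{u, v} k) (B : GrSpace.{u, w} k) where
  lin : A →ₗ[k] B
  map_gr : ∀ d, ∀ a ∈ A.gr d, lin a ∈ B.gr d

namespace GrHom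

variable {k : Type u} [Field k]

lemma proj_comm {A : GrSpace.{u, v} k} {B : GrSpace.{u, w} k} (f : GrHom A B) (d : ℤ) (a : A) :
    B.proj d (f.lin a) = f.lin (A.proj d a) := by
  refine A.induction_gr (p := fun a => B.proj d (f.lin a) = f.lin (A.proj d a)) a ?_ (by simp) ?_
  · intro e b hb
    rw [B.proj_of_mem (f.map_gr e b hb), A.proj_of_mem hb]
    split_ifs <;> simp
  · intro b c hb hc
    simp only [map_add, hb, hc]

/-- The inverse of a bijective degree-preserving map. -/
def inverse {A : GrSpace.{u, v} k} {B : GrSpace.{u, w} k} (f : GrHom A B)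
    (hf : Function.Bijective f.lin) : GrHom B A where
  lin := (LinearEquiv.ofBijective f.lin hf).symm.toLinearMap
  map_gr d b hb := by
    obtain ⟨a, rfl⟩ := hf.2 b
    have : (LinearEquiv.ofBijective f.lin hf).symm (f.lin a) = a := by
      rw [LinearEquiv.symm_apply_eq]; rfl
    rw [LinearEquiv.coe_coe, this]
    refine A.mem_gr_of_proj fun e he => hf.1 ?_
    rw [← f.proj_comm, B.proj_of_mem hb, if_neg (Ne.symm he), map_zero]

/-- A degree-preserving map `A → B` seen as a map `A[m] → B[m]`. -/
@[reducible] def shift {A : GrSpace.{u, v} k} {B : GrSpace.{u, w} k} (f : GrHom A B) (m : ℤ) :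
    GrHom (A.shift m) (B.shift m) where
  lin := f.lin
  map_gr d a ha := f.map_gr (d + m) a ha

/-- The transpose. -/
@[reducible] def dual {A : GrSpace.{u, v} k} {B : GrSpace.{u, w} k} (f : GrHom A B) :
    GrHom B.dual A.dual where
  lin := f.lin.dualMap
  map_gr _ _ hφ e he a ha := hφ e he _ (f.map_gr e a ha)

@[reducible] def inl (A : GrSpace.{u, v} k) (B : GrSpace.{u, w} k) : GrHom A (A.prod B) where
  lin := LinearMap.inl k A B
  map_gr _ _ ha := ⟨ha, zero_mem _⟩

@[reducible] def inr (A : GrSpace.{u, v} k) (B : GrSpace.{u, w} k) : GrHom B (A.prod B) where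
  lin := LinearMap.inr k A B
  map_gr _ _ ha := ⟨zero_mem _, ha⟩

/-- `(a, b) ↦ f a + g b`. -/
@[reducible] def coprod {A : GrSpace.{u, v} k} {B : GrSpace.{u, w} k} {C : GrSpace.{u, x} k}
    (f : GrHom A C) (g : GrHom B C) : GrHom (A.prod B) C where
  lin := f.lin.coprod g.lin
  map_gr d _ ha := add_mem (f.map_gr d _ ha.1) (g.map_gr d _ ha.2)

end GrHom

/-! ### The graded symmetric algebra and its completion -/

/-- The relations `a b = (-1) ^ (|a| |b|) b a`. -/
inductive GSym.Rel {k : Type u} [Field k] (A : GrSpace.{u, v} k) :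
    TensorAlgebra k A → TensorAlgebra k A → Prop
  | comm {d e : ℤ} {a b : A} (ha : a ∈ A.gr d) (hb : b ∈ A.gr e) :
      GSym.Rel A (TensorAlgebra.ι k a * TensorAlgebra.ι k b)
        (ksign k (d * e) • (TensorAlgebra.ι k b * TensorAlgebra.ι k a))

/-- The graded symmetric algebra `Sym(A)` (in characteristic different from `2`). -/
abbrev GSym {k : Type u} [Field k] (A : GrSpace.{u, v} k) : Type (max u v) :=
  RingQuot (GSym.Rel A)

namespace GSym

variable {k : Type u} [Field k]

/-- The inclusion of the generators. -/
def ι (A : GrSpace.{u, v} k) : A →ₗ[k] GSym A :=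
  (RingQuot.mkAlgHom k (Rel A)).toLinearMap ∘ₗ TensorAlgebra.ι k

lemma ι_comm (A : GrSpace.{u, v} k) {d e : ℤ} {a b : A} (ha : a ∈ A.gr d) (hb : b ∈ A.gr e) :
    ι A a * ι A b = ksign k (d * e) • (ι A b * ι A a) := by
  have := RingQuot.mkAlgHom_rel k (Rel.comm (A := A) ha hb)
  simpa [ι] using this

/-- The universal property of `Sym(A)`. -/
def lift {A : GrSpace.{u, v} k} {R : Type w} [Ring R] [Algebra k R] (f : A →ₗ[k] R)
    (hf : ∀ d e, ∀ a ∈ A.gr d, ∀ b ∈ A.gr e, f a * f b = ksign k (d * e) • (f b * f a)) :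
    GSym A →ₐ[k] R :=
  RingQuot.liftAlgHom k ⟨TensorAlgebra.lift k f, by
    rintro _ _ ⟨ha, hb⟩
    simpa using hf _ _ _ ha _ hb⟩

lemma lift_ι {A : GrSpace.{u, v} k} {R : Type w} [Ring R] [Algebra k R] (f : A →ₗ[k] R)
    (hf : ∀ d e, ∀ a ∈ A.gr d, ∀ b ∈ A.gr e, f a * f b = ksign k (d * e) • (f b * f a)) (a : A) :
    lift f hf (ι A a) = f a := by
  simp [lift, ι, RingQuot.liftAlgHom_mkAlgHom_apply]

/-- The `p`-th symmetric power `Sym^p(A)`, inside `Sym(A)`. -/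
def pow (A : GrSpace.{u, v} k) (p : ℕ) : Submodule k (GSym A) := LinearMap.range (ι A) ^ p

/-- The elements of cohomological degree `d` of `Sym(A)`. -/
def homog (A : GrSpace.{u, v} k) (d : ℤ) : Submodule k (GSym A) :=
  Submodule.span k {a | ∃ l : List (ℤ × A), (∀ y ∈ l, y.2 ∈ A.gr y.1) ∧
    (l.map Prod.fst).sum = d ∧ (l.map fun y => ι A y.2).prod = a}

/-- Functoriality of `Sym`. -/
def map {A : GrSpace.{u, v} k} {B : GrSpace.{u, w} k} (f : GrHom A B) : GSym A →ₐ[k] GSym B :=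
  lift (ι B ∘ₗ f.lin) fun d e a ha b hb => ι_comm B (f.map_gr d a ha) (f.map_gr e b hb)

lemma map_mem_pow {A : GrSpace.{u, v} k} {B : GrSpace.{u, w} k} (f : GrHom A B) (p : ℕ)
    {a : GSym A} (ha : a ∈ pow A p) : map f a ∈ pow B p := by
  have h : (pow A p).map (map f).toLinearMap ≤ pow B p := by
    rw [pow, pow, Submodule.map_pow]
    refine pow_le_pow_left' ?_ p
    rintro _ ⟨_, ⟨y, rfl⟩, rfl⟩
    exact ⟨f.lin y, by simp [map, lift_ι]⟩
  exact h ⟨a, ha, rfl⟩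

/-- The algebra map `a ↦ [[σ^i a, D a], [0, σ^j a]]`, where `σ` is the parity involution and `D`
is the twisted derivation, `D (a b) = D(a) σ^j(b) + σ^i(a) D(b)`, whose values on the generators
are given by the part of `φ` of the parity of `i + j`. -/
def contractHom (A : GrSpace.{u, v} k) (i j : ℤ) (φ : Module.Dual k A) :
    GSym A →ₐ[k] Matrix (Fin 2) (Fin 2) (GSym A) :=
  lift
    { toFun := fun a => !![ι A (A.sgn i a), algebraMap k _ (φ (A.parity (i + j) a));
        0, ι A (A.sgn j a)]
      map_add' := fun a b => by ext p q; fin_cases p <;> fin_cases q <;> simp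
      map_smul' := fun c a => by
        ext p q; fin_cases p <;> fin_cases q <;> simp [Algebra.smul_def] } (by
    intro d e a ha b hb
    have hc := ι_comm A ha hb
    have aux : ∀ i j d e : ℤ, Even (e + (i + j)) →
        ksign k (i * d) = ksign k (d * e) * ksign k (j * d) := by
      intro i j d e he
      simp only [ksign, ← Int.cast_mul, ← Units.val_mul, ← Int.negOnePow_add]
      congr 2
      rw [Int.negOnePow_eq_iff]
      have : i * d - (d * e + j * d) = d * ((e + (i + j)) - 2 * (e + j)) := by ring
      rw [this]
      exact (he.sub (even_two_mul _)).mul_left d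
    have key : ksign k (i * d) * φ (A.parity (i + j) b)
        = ksign k (d * e) * (ksign k (j * d) * φ (A.parity (i + j) b)) := by
      rw [GrSpace.parity, diag_of_mem A _ hb]
      by_cases he : Even (e + (i + j))
      · rw [aux i j d e he, mul_assoc]
      · simp [he]
    have key' : ksign k (j * e) * φ (A.parity (i + j) a)
        = ksign k (d * e) * (ksign k (i * e) * φ (A.parity (i + j) a)) := by
      rw [GrSpace.parity, diag_of_mem A _ ha]
      by_cases he : Even (d + (i + j))
      · rw [aux j i e d (by rwa [add_comm j i]), mul_comm e d, mul_assoc]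
      · simp [he]
    have hs : ∀ m : ℤ, A.sgn m a = ksign k (m * d) • a := fun m => diag_of_mem A _ ha
    have hs' : ∀ m : ℤ, A.sgn m b = ksign k (m * e) • b := fun m => diag_of_mem A _ hb
    ext p q
    fin_cases p <;> fin_cases q
    · simp [hs, hs', hc, smul_smul]
      ring_nf
    · simp only [LinearMap.coe_mk, AddHom.coe_mk, hs, hs', map_smul, Fin.zero_eta, Fin.mk_one,
        Matrix.mul_apply, Matrix.smul_apply, Fin.sum_univ_two, Matrix.of_apply, Matrix.cons_val',
        Matrix.cons_val_zero, Matrix.cons_val_one, Matrix.cons_val_fin_one]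
      rw [← Algebra.commutes, ← Algebra.commutes, ← Algebra.smul_def, ← Algebra.smul_def,
        ← Algebra.smul_def, ← Algebra.smul_def]
      simp only [smul_smul, smul_add]
      rw [mul_comm _ (ksign k (i * d)), key, mul_comm _ (ksign k (j * e)), key',
        mul_comm _ (ksign k (i * e)), mul_comm _ (ksign k (j * d)), add_comm]
    · simp
    · simp [hs, hs', hc, smul_smul]
      ring_nf)

lemma contractHom_ι (A : GrSpace.{u, v} k) (i j : ℤ) (φ : Module.Dual k A) (a : A) :
    contractHom A i j φ (ι A a) =
      !![ι A (A.sgn i a), algebraMap k _ (φ (A.parity (i + j) a)); 0, ι A (A.sgn j a)] :=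
  lift_ι _ _ a

/-- The twisted derivation in the upper right corner of `contractHom`. -/
def contract (A : GrSpace.{u, v} k) (i j : ℤ) (φ : Module.Dual k A) : GSym A →ₗ[k] GSym A where
  toFun a := contractHom A i j φ a 0 1
  map_add' a b := by simp
  map_smul' c a := by simp

lemma contractHom_lower (A : GrSpace.{u, v} k) (i j : ℤ) (φ : Module.Dual k A) (p : ℕ)
    (a : GSym A) (ha : a ∈ pow A p) :
    contractHom A i j φ a 0 0 ∈ pow A p ∧ contractHom A i j φ a 1 1 ∈ pow A p ∧
      contractHom A i j φ a 1 0 = 0 ∧ (p = 0 → contractHom A i j φ a 0 1 = 0) ∧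
      ∀ q, p = q + 1 → contractHom A i j φ a 0 1 ∈ pow A q := by
  unfold pow at ha
  induction ha using Submodule.pow_induction_on_left' with
  | algebraMap r =>
    have h1 : algebraMap k (GSym A) r ∈ pow A 0 := by
      rw [pow, pow_zero]; exact Submodule.algebraMap_mem r
    have h2 : contractHom A i j φ (algebraMap k (GSym A) r)
        = algebraMap k (Matrix (Fin 2) (Fin 2) (GSym A)) r := AlgHom.commutes _ _
    simp only [h2, Matrix.algebraMap_matrix_apply]
    exact ⟨h1, h1, rfl, fun _ => rfl, fun q hq => absurd hq (by omega)⟩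
  | add b c p hb hc ihb ihc =>
    simp only [map_add, Matrix.add_apply]
    exact ⟨add_mem ihb.1 ihc.1, add_mem ihb.2.1 ihc.2.1, by rw [ihb.2.2.1, ihc.2.2.1, add_zero],
      fun h => by rw [ihb.2.2.2.1 h, ihc.2.2.2.1 h, add_zero],
      fun q hq => add_mem (ihb.2.2.2.2 q hq) (ihc.2.2.2.2 q hq)⟩
  | mem_mul m hm p b hb ih =>
    obtain ⟨y, rfl⟩ := hm
    have hι : ∀ z : A, ι A z ∈ LinearMap.range (ι A) := fun z => ⟨z, rfl⟩
    have hmul : ∀ (z : A) (q : ℕ) (c : GSym A), c ∈ pow A q → ι A z * c ∈ pow A (q + 1) := by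
      intro z q c hc
      rw [pow, pow_succ']
      exact Submodule.mul_mem_mul (hι z) hc
    simp only [map_mul, Matrix.mul_apply, Fin.sum_univ_two, contractHom_ι, Matrix.of_apply,
      Matrix.cons_val', Matrix.cons_val_zero, Matrix.cons_val_one, Matrix.cons_val_fin_one,
      ih.2.2.1, mul_zero, zero_mul, add_zero, zero_add]
    refine ⟨hmul _ _ _ ih.1, hmul _ _ _ ih.2.1, trivial, fun h => absurd h (by omega), ?_⟩
    intro q hq
    obtain rfl : p = q := by omega
    refine add_mem ?_ ?_
    · rcases p with _ | p
      · rw [ih.2.2.2.1 rfl, mul_zero]; exact zero_mem _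
      · exact hmul _ _ _ (ih.2.2.2.2 p rfl)
    · rw [← Algebra.smul_def]
      exact Submodule.smul_mem _ _ ih.2.1

lemma contract_mem_pow (A : GrSpace.{u, v} k) (i j : ℤ) (φ : Module.Dual k A) (p : ℕ)
    {a : GSym A} (ha : a ∈ pow A (p + 1)) : contract A i j φ a ∈ pow A p :=
  (contractHom_lower A i j φ (p + 1) a ha).2.2.2.2 p rfl

lemma induction {A : GrSpace.{u, v} k} {P : GSym A → Prop} (a : GSym A)
    (hc : ∀ r, P (algebraMap k _ r)) (hι : ∀ y, P (ι A y)) (hm : ∀ b c, P b → P c → P (b * c))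
    (ha : ∀ b c, P b → P c → P (b + c)) : P a := by
  obtain ⟨t, rfl⟩ := RingQuot.mkAlgHom_surjective k (Rel A) a
  induction t using TensorAlgebra.induction with
  | algebraMap r => simpa using hc r
  | ι y => exact hι y
  | mul b c hb hc => rw [map_mul]; exact hm _ _ hb hc
  | add b c hb hc => rw [map_add]; exact ha _ _ hb hc

lemma contractHom_indep (A : GrSpace.{u, v} k) (i j : ℤ) (φ ψ : Module.Dual k A) (a : GSym A) :
    contractHom A i j φ a 0 0 = contractHom A i j ψ a 0 0 ∧
      contractHom A i j φ a 1 1 = contractHom A i j ψ a 1 1 ∧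
      contractHom A i j φ a 1 0 = 0 ∧ contractHom A i j ψ a 1 0 = 0 := by
  induction a using GSym.induction with
  | hc r => simp [Matrix.algebraMap_matrix_apply]
  | hι y => simp [contractHom_ι]
  | hm b c hb hc =>
    simp [Matrix.mul_apply, Fin.sum_univ_two, hb.1, hb.2.1, hb.2.2.1, hb.2.2.2, hc.1, hc.2.1,
      hc.2.2.1, hc.2.2.2]
  | ha b c hb hc =>
    simp [hb.1, hb.2.1, hb.2.2.1, hb.2.2.2, hc.1, hc.2.1, hc.2.2.1, hc.2.2.2]

lemma contract_mul (A : GrSpace.{u, v} k) (i j : ℤ) (φ : Module.Dual k A) (a b : GSym A) :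
    contract A i j φ (a * b) =
      contractHom A i j 0 a 0 0 * contract A i j φ b +
        contract A i j φ a * contractHom A i j 0 b 1 1 := by
  simp only [contract, LinearMap.coe_mk, AddHom.coe_mk, map_mul, Matrix.mul_apply,
    Fin.sum_univ_two]
  rw [(contractHom_indep A i j φ 0 a).1, (contractHom_indep A i j φ 0 b).2.1]

lemma contract_linear (A : GrSpace.{u, v} k) (i j : ℤ) (r : k) (φ ψ : Module.Dual k A)
    (a : GSym A) :
    contract A i j (r • φ + ψ) a = r • contract A i j φ a + contract A i j ψ a := by
  induction a using GSym.induction with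
  | hc r => simp [contract, Matrix.algebraMap_matrix_apply]
  | hι y => simp [contract, contractHom_ι, Algebra.smul_def]
  | hm b c hb hc =>
    simp only [contract_mul, hb, hc, mul_add, add_mul, smul_add, mul_smul_comm, smul_mul_assoc]
    abel
  | ha b c hb hc =>
    simp only [map_add, hb, hc, smul_add]
    abel

/-- The contraction `∂_φ` of `Sym(A)` with a functional `φ`: the left derivation with
`∂_φ (a) = φ a` on generators, so that
`∂_φ (a b) = ∂_φ(a) b + (-1) ^ (|φ| |a|) a ∂_φ(b)`. -/
def leftDeriv (A : GrSpace.{u, v} k) (φ : Module.Dual k A) : GSym A →ₗ[k] GSym A :=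
  contract A 0 0 φ + contract A 1 0 φ

/-- The right derivation with the value `φ a` on generators:
`(a b)∂_φ = a (b ∂_φ) + (-1) ^ (|φ| |b|) (a ∂_φ) b`. -/
def rightDeriv (A : GrSpace.{u, v} k) (φ : Module.Dual k A) : GSym A →ₗ[k] GSym A :=
  contract A 0 0 φ + contract A 0 1 φ

/-- The algebra map `Sym(A ⊕ B) → Sym(A ⊕ B)[t]`, `a ↦ a`, `b ↦ t b`. -/
def weightHom (A : GrSpace.{u, v} k) (B : GrSpace.{u, w} k) :
    GSym (A.prod B) →ₐ[k] (GSym (A.prod B))[X] :=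
  lift
    { toFun := fun y : A × B => Polynomial.C (ι (A.prod B) (y.1, 0)) +
        Polynomial.X * Polynomial.C (ι (A.prod B) (0, y.2))
      map_add' := fun y z => by
        have h1 : ((y + z).1, (0 : B)) = (y.1, 0) + (z.1, 0) := by simp
        have h2 : ((0 : A), (y + z).2) = (0, y.2) + (0, z.2) := by simp
        rw [h1, h2, map_add, map_add, map_add, map_add, mul_add]
        abel
      map_smul' := fun c y => by
        have h1 : ((c • y).1, (0 : B)) = c • (y.1, 0) := by simp
        have h2 : ((0 : A), (c • y).2) = c • (0, y.2) := by simp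
        rw [h1, h2, LinearMap.map_smul, LinearMap.map_smul, RingHom.id_apply, smul_add,
          ← Polynomial.smul_C, ← Polynomial.smul_C, mul_smul_comm] } (by
    intro d e y hy z hz
    have hc : ∀ p ∈ (A.prod B).gr d, ∀ q ∈ (A.prod B).gr e,
        (Polynomial.C (ι (A.prod B) p) * Polynomial.C (ι (A.prod B) q) : (GSym (A.prod B))[X])
          = ksign k (d * e) • (Polynomial.C (ι (A.prod B) q) * Polynomial.C (ι (A.prod B) p)) := by
      intro p hp q hq
      rw [← Polynomial.C_mul, ι_comm _ hp hq, ← Polynomial.C_mul, ← Polynomial.smul_C]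
    have hX : ∀ F : (GSym (A.prod B))[X], F * Polynomial.X = Polynomial.X * F :=
      fun F => (Polynomial.X_mul (p := F)).symm
    have y1 : (y.1, (0 : B)) ∈ (A.prod B).gr d := ⟨hy.1, zero_mem _⟩
    have y2 : ((0 : A), y.2) ∈ (A.prod B).gr d := ⟨zero_mem _, hy.2⟩
    have z1 : (z.1, (0 : B)) ∈ (A.prod B).gr e := ⟨hz.1, zero_mem _⟩
    have z2 : ((0 : A), z.2) ∈ (A.prod B).gr e := ⟨zero_mem _, hz.2⟩
    have comm1 : ∀ F G : (GSym (A.prod B))[X], F * (Polynomial.X * G) = Polynomial.X * (F * G) :=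
      fun F G => by rw [← mul_assoc, hX, mul_assoc]
    simp only [LinearMap.coe_mk, AddHom.coe_mk, mul_add, add_mul, comm1, mul_assoc,
      hc _ y1 _ z1, hc _ y1 _ z2, hc _ y2 _ z1, hc _ y2 _ z2, smul_add, mul_smul_comm]
    abel)

/-- The part of weight `j` in the generators from `B`, of an element of `Sym(A ⊕ B)`. -/
def weightPart (A : GrSpace.{u, v} k) (B : GrSpace.{u, w} k) (j : ℕ) :
    GSym (A.prod B) →ₗ[k] GSym (A.prod B) where
  toFun a := (weightHom A B a).coeff j
  map_add' a b := by simp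
  map_smul' c a := by simp

lemma weightPart_mem_pow (A : GrSpace.{u, v} k) (B : GrSpace.{u, w} k) (j p : ℕ)
    {a : GSym (A.prod B)} (ha : a ∈ pow (A.prod B) p) :
    weightPart A B j a ∈ pow (A.prod B) p := by
  unfold pow at ha
  induction ha using Submodule.pow_induction_on_left' generalizing j with
  | algebraMap r =>
    simp only [weightPart, LinearMap.coe_mk, AddHom.coe_mk, AlgHom.commutes,
      Polynomial.algebraMap_apply, Polynomial.coeff_C, pow, pow_zero]
    split_ifs
    · exact Submodule.algebraMap_mem r
    · exact zero_mem _
  | add b c p hb hc ihb ihc =>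
    rw [map_add]; exact add_mem (ihb j) (ihc j)
  | mem_mul m hm p b hb ih =>
    obtain ⟨y, rfl⟩ := hm
    have hmul : ∀ (z : A.prod B) (c : GSym (A.prod B)), c ∈ pow (A.prod B) p →
        ι (A.prod B) z * c ∈ pow (A.prod B) (p + 1) := by
      intro z c hc
      rw [pow, pow_succ']
      exact Submodule.mul_mem_mul ⟨z, rfl⟩ hc
    have h1 : weightHom A B (ι (A.prod B) y) = Polynomial.C (ι (A.prod B) (y.1, 0)) +
        Polynomial.X * Polynomial.C (ι (A.prod B) (0, y.2)) := lift_ι _ _ y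
    have h2 : weightPart A B j (ι (A.prod B) y * b)
        = ι (A.prod B) (y.1, 0) * weightPart A B j b +
          (Polynomial.X * (Polynomial.C (ι (A.prod B) (0, y.2)) * weightHom A B b)).coeff j := by
      simp only [weightPart, LinearMap.coe_mk, AddHom.coe_mk, map_mul, h1, add_mul, mul_assoc,
        Polynomial.coeff_add, Polynomial.coeff_C_mul]
    rw [h2]
    refine add_mem (hmul _ _ (ih j)) ?_
    rcases j with _ | j
    · simp
    · rw [Polynomial.coeff_X_mul, Polynomial.coeff_C_mul]
      exact hmul _ _ (ih j)

end GSym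

/-- The completed graded symmetric algebra `∏_p Sym^p(A)`, realised as the algebra of formal power
series `∑ F_p t^p` over `Sym(A)` with `F_p ∈ Sym^p(A)`. -/
def CSym {k : Type u} [Field k] (A : GrSpace.{u, v} k) : Subalgebra k (PowerSeries (GSym A)) where
  carrier := {F | ∀ p, PowerSeries.coeff p F ∈ GSym.pow A p}
  mul_mem' {F G} hF hG p := by
    rw [PowerSeries.coeff_mul]
    refine sum_mem fun q hq => ?_
    rw [← Finset.HasAntidiagonal.mem_antidiagonal.1 hq, GSym.pow, pow_add]
    exact Submodule.mul_mem_mul (hF _) (hG _)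
  add_mem' {F G} hF hG p := by
    rw [map_add]; exact add_mem (hF p) (hG p)
  algebraMap_mem' r p := by
    rw [PowerSeries.algebraMap_apply, PowerSeries.coeff_C]
    split_ifs with h
    · subst h
      rw [GSym.pow, pow_zero]; exact Submodule.algebraMap_mem r
    · exact zero_mem _

namespace CSym

variable {k : Type u} [Field k]

/-- The component `F_p ∈ Sym^p(A)`. -/
def coeff {A : GrSpace.{u, v} k} (p : ℕ) (F : CSym A) : GSym A := PowerSeries.coeff p F.1

def ofCoeff {A : GrSpace.{u, v} k} (c : ℕ → GSym A) (hc : ∀ p, c p ∈ GSym.pow A p) : CSym A :=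
  ⟨PowerSeries.mk c, fun p => by rw [PowerSeries.coeff_mk]; exact hc p⟩

/-- The extension to the completion of a linear map sending `Sym^(p+s)` to `Sym^p` for all `p`. -/
def extend {A : GrSpace.{u, v} k} {B : GrSpace.{u, w} k} (s : ℕ) (T : GSym A →ₗ[k] GSym B)
    (hT : ∀ p, ∀ a ∈ GSym.pow A (p + s), T a ∈ GSym.pow B p) : CSym A →ₗ[k] CSym B where
  toFun F := ofCoeff (fun p => T (coeff (p + s) F)) fun p => hT p _ (F.2 (p + s))
  map_add' F G := by
    refine Subtype.ext (PowerSeries.ext fun p => ?_)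
    simp [ofCoeff, coeff]
  map_smul' r F := by
    refine Subtype.ext (PowerSeries.ext fun p => ?_)
    simp [ofCoeff, coeff]

/-- The inclusion of the generators. -/
def gen (A : GrSpace.{u, v} k) (a : A) : CSym A :=
  ofCoeff (fun p => if p = 1 then GSym.ι A a else 0) fun p => by
    split_ifs with h
    · subst h
      rw [GSym.pow, pow_one]; exact ⟨a, rfl⟩
    · exact zero_mem _

/-- `F` has cohomological degree `d`. -/
def IsHomog {A : GrSpace.{u, v} k} (d : ℤ) (F : CSym A) : Prop :=
  ∀ p, coeff p F ∈ GSym.homog A d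

def map {A : GrSpace.{u, v} k} {B : GrSpace.{u, w} k} (f : GrHom A B) : CSym A →ₗ[k] CSym B :=
  extend 0 (GSym.map f).toLinearMap fun p _ ha => GSym.map_mem_pow f p ha

def leftDeriv {A : GrSpace.{u, v} k} (φ : Module.Dual k A) : CSym A →ₗ[k] CSym A :=
  extend 1 (GSym.leftDeriv A φ) fun p _ ha =>
    add_mem (GSym.contract_mem_pow A 0 0 φ p ha) (GSym.contract_mem_pow A 1 0 φ p ha)

def rightDeriv {A : GrSpace.{u, v} k} (φ : Module.Dual k A) : CSym A →ₗ[k] CSym A :=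
  extend 1 (GSym.rightDeriv A φ) fun p _ ha =>
    add_mem (GSym.contract_mem_pow A 0 0 φ p ha) (GSym.contract_mem_pow A 0 1 φ p ha)

lemma rightDeriv_linear {A : GrSpace.{u, v} k} (r : k) (φ ψ : Module.Dual k A) (F : CSym A) :
    rightDeriv (r • φ + ψ) F = r • rightDeriv φ F + rightDeriv ψ F := by
  refine Subtype.ext (PowerSeries.ext fun p => ?_)
  simp [rightDeriv, extend, ofCoeff, GSym.rightDeriv, GSym.contract_linear, smul_add]
  abel

lemma rightDeriv_add {A : GrSpace.{u, v} k} (φ ψ : Module.Dual k A) (F : CSym A) :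
    rightDeriv (φ + ψ) F = rightDeriv φ F + rightDeriv ψ F := by
  simpa using rightDeriv_linear 1 φ ψ F

lemma rightDeriv_smul {A : GrSpace.{u, v} k} (r : k) (φ : Module.Dual k A) (F : CSym A) :
    rightDeriv (r • φ) F = r • rightDeriv φ F := by
  have h0 : rightDeriv (0 : Module.Dual k A) F = 0 := by
    simpa using rightDeriv_add (0 : Module.Dual k A) 0 F
  simpa [h0] using rightDeriv_linear r φ 0 F

end CSym

/-! ### Formal moduli problems, through their `L_∞` algebras

A formal moduli problem `X` is represented by the underlying graded vector space `G` of the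
`L_∞` algebra `𝔤 = T_o[-1] X`. -/

section Formal

variable {k : Type u} [Field k]

/-- The formal functions `O(X) = Sym^(𝔤*[-1])`; note that `𝔤*[-1] = (𝔤[1])*`. -/
abbrev Fun (G : GrSpace.{u, v} k) : Subalgebra k (PowerSeries (GSym (G.shift 1).dual)) :=
  CSym (G.shift 1).dual

/-- A vector field on `X`: an element of `∏_p Hom(Sym^p(𝔤[1]), 𝔤[1])`, given by its values on
the linear coordinate functions. -/
abbrev VectorField (G : GrSpace.{u, v} k) : Type (max u v) := (G.shift 1).dual →ₗ[k] Fun G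

/-- The left derivative of a function in the direction of the constant vector field `y ∈ 𝔤[1]`. -/
def dirDeriv {G : GrSpace.{u, v} k} (y : G) : Fun G →ₗ[k] Fun G :=
  CSym.leftDeriv (A := (G.shift 1).dual) (Module.Dual.eval k G y)

/-- The right derivative of a function in the direction of the constant vector field `y ∈ 𝔤[1]`. -/
def dirDerivRight {G : GrSpace.{u, v} k} (y : G) : Fun G →ₗ[k] Fun G :=
  CSym.rightDeriv (A := (G.shift 1).dual) (Module.Dual.eval k G y)

namespace VectorField

/-- The action of a vector field on functions, `Q(F) = ∑_i Q(x^i) ∂F/∂x^i` in linear coordinates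
`x^i` (the sum does not depend on the basis). -/
def act {G : GrSpace.{u, v} k} (Q : VectorField G) (F : Fun G) : Fun G :=
  ∑ i, Q ((Module.finBasis k G).coord i) * dirDeriv (Module.finBasis k G i) F

def IsHomog {G : GrSpace.{u, v} k} (m : ℤ) (Q : VectorField G) : Prop :=
  ∀ d, ∀ ξ ∈ (G.shift 1).dual.gr d, CSym.IsHomog (d + m) (Q ξ)

/-- `Q` is the cohomological vector field (Chevalley-Eilenberg differential) of an `L_∞` algebra
structure on `𝔤`: it has degree `1`, vanishes at the base point, and squares to zero. -/
structure IsLInfinity {G : GrSpace.{u, v} k} (Q : VectorField G) : Prop where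
  degree : Q.IsHomog 1
  base : ∀ ξ, CSym.coeff 0 (Q ξ) = 0
  square : ∀ F, Q.act (Q.act F) = 0

end VectorField

/-- A strict, constant coefficient `n`-shifted symplectic form: a graded symmetric isomorphism
`ω : 𝔤 → 𝔤*[n-2]`. -/
structure ShiftedSymplectic (G : GrSpace.{u, v} k) (n : ℤ) where
  form : G ≃ₗ[k] Module.Dual k G
  degree : ∀ d e, ∀ y ∈ G.gr d, ∀ z ∈ G.gr e, d + e ≠ 2 - n → form y z = 0
  symm : ∀ d e, ∀ y ∈ G.gr d, ∀ z ∈ G.gr e, form y z = ksign k (d * e) * form z y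

namespace ShiftedSymplectic

variable {G : GrSpace.{u, v} k} {n : ℤ}

/-- The same form on `𝔤[1]`, where it is graded antisymmetric: `Ω(y, z) = (-1) ^ |y| ω(y, z)`,
with `|y|` the degree of `y` in `𝔤`. -/
def shifted (ω : ShiftedSymplectic G n) : G →ₗ[k] Module.Dual k G :=
  ω.form.toLinearMap ∘ₗ G.sgn 1

/-- The Hamiltonian vector field `Q_S` of a function `S`, characterised by
`Q_S (Ω(y, ·)) = S ∂_y` (right derivative) for `y ∈ 𝔤[1]`. -/
def hamiltonian (ω : ShiftedSymplectic G n) (S : Fun G) : VectorField G where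
  toFun ξ := dirDerivRight (G.sgn 1 (ω.form.symm ξ)) S
  map_add' ξ η := by
    rw [map_add, map_add, dirDerivRight, map_add]
    exact CSym.rightDeriv_add _ _ S
  map_smul' c ξ := by
    rw [map_smul, map_smul, dirDerivRight, map_smul]
    exact CSym.rightDeriv_smul _ _ S

/-- The Poisson bracket `{S, F}_ω = Q_S(F)`. -/
def bracket (ω : ShiftedSymplectic G n) (S F : Fun G) : Fun G := (ω.hamiltonian S).act F

end ShiftedSymplectic

/-- The pullback of functions along the map of formal moduli problems given by a strict (linear)
map of the `L_∞` algebras. -/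
def pullback {G : GrSpace.{u, v} k} {L : GrSpace.{u, w} k} (f : GrHom L G) :
    Fun G →ₗ[k] Fun L :=
  CSym.map (f.shift 1).dual

/-- `f` is a strict map of `L_∞` algebras: the pullback of functions is a cochain map. -/
def IsStrictMap {G : GrSpace.{u, v} k} {L : GrSpace.{u, w} k} (f : GrHom L G)
    (Q' : VectorField L) (Q : VectorField G) : Prop :=
  ∀ F, pullback f (Q.act F) = Q'.act (pullback f F)

/-! ### Polyvector fields -/

/-- The `(n-1)`-shifted polyvector fields of all degrees on the formal moduli problem `L`,
`∏_j Γ(L, Sym^j(T_L[-n])) = Sym^(𝔩*[-1]) ⊗^ Sym^(𝔩[1-n])`. -/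
abbrev PolyVec (n : ℤ) (L : GrSpace.{u, v} k) :
    Subalgebra k (PowerSeries (GSym ((L.shift 1).dual.prod (L.shift (1 - n))))) :=
  CSym ((L.shift 1).dual.prod (L.shift (1 - n)))

namespace PolyVec

variable {n : ℤ} {L : GrSpace.{u, v} k}

/-- A function as a polyvector field of degree `0`. -/
def ofFun (n : ℤ) (L : GrSpace.{u, v} k) : Fun L →ₗ[k] PolyVec n L :=
  CSym.map (GrHom.inl (L.shift 1).dual (L.shift (1 - n)))

/-- The constant vector field `y`, as a generator in `T_L[-n]`. -/
def θ (n : ℤ) (L : GrSpace.{u, v} k) (y : L) : PolyVec n L :=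
  CSym.gen ((L.shift 1).dual.prod (L.shift (1 - n))) (0, y)

/-- A vector field as a polyvector field of degree `1`: `∑_i Q(x^i) θ_i`. -/
def ofVectorField (n : ℤ) {L : GrSpace.{u, v} k} (Q : VectorField L) : PolyVec n L :=
  ∑ i, ofFun n L (Q ((Module.finBasis k L).coord i)) * θ n L (Module.finBasis k L i)

/-- The space `Γ(L, Sym^j(T_L[-n]))` of polyvector fields of degree `j`. -/
def IsPolyDegree (j : ℕ) (P : PolyVec n L) : Prop :=
  ∀ p, CSym.coeff p P ∈ ⨆ (i : ℕ) (_ : i + j = p),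
    LinearMap.range (GSym.ι ((L.shift 1).dual.prod (L.shift (1 - n))) ∘ₗ
      LinearMap.inl k (Module.Dual k L) L) ^ i *
    LinearMap.range (GSym.ι ((L.shift 1).dual.prod (L.shift (1 - n))) ∘ₗ
      LinearMap.inr k (Module.Dual k L) L) ^ j

/-- The component of polyvector degree `j`. -/
def component (j : ℕ) : PolyVec n L →ₗ[k] PolyVec n L :=
  CSym.extend 0 (GSym.weightPart (L.shift 1).dual (L.shift (1 - n)) j) fun p _ ha =>
    GSym.weightPart_mem_pow _ _ j p ha

/-- The sum `∑_{j ≥ 2} P_j` of a tower of polyvector fields `P_j` of degree `j`; only finitely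
many terms contribute to the component in a given symmetric power. -/
def tower (P : ℕ → PolyVec n L) : PolyVec n L :=
  CSym.ofCoeff (fun p => ∑ j ∈ Finset.Icc 2 p, CSym.coeff p (P j)) fun p =>
    sum_mem fun j _ => (P j).2 p

/-- Derivatives in the direction of `y ∈ 𝔩[1]` (along `L`) and in the direction of a functional
on the fibre coordinates `𝔩[1-n]`. -/
def baseDual (n : ℤ) {L : GrSpace.{u, v} k} (y : L) :
    Module.Dual k ((L.shift 1).dual.prod (L.shift (1 - n))) :=
  Module.Dual.eval k L y ∘ₗ LinearMap.fst k (Module.Dual k L) L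

def fibreDual (n : ℤ) {L : GrSpace.{u, v} k} (η : Module.Dual k L) :
    Module.Dual k ((L.shift 1).dual.prod (L.shift (1 - n))) :=
  η ∘ₗ LinearMap.snd k (Module.Dual k L) L

/-- The Schouten bracket
`[P, R] = ∑_i (P ∂/∂θ_i) (∂/∂x^i R) - (-1) ^ ((n+1) |e_i|) (P ∂/∂x^i) (∂/∂θ_i R)`,
with right derivatives of `P` and left derivatives of `R`, for a basis `e_i` of `𝔩[1]`. It is the
biderivation of degree `-n` which vanishes on pairs of functions, with `[Q, F] = Q(F)` for a vector
field `Q` and a function `F`, and which restricts to the Lie bracket of vector fields. -/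
def schouten (P R : PolyVec n L) : PolyVec n L :=
  ∑ i, (CSym.rightDeriv (fibreDual n ((Module.finBasis k L).coord i)) P *
      CSym.leftDeriv (baseDual n (Module.finBasis k L i)) R -
    CSym.rightDeriv (baseDual (L := L) n ((L.shift 1).sgn (n + 1) (Module.finBasis k L i))) P *
      CSym.leftDeriv (fibreDual n ((Module.finBasis k L).coord i)) R)

/-- A tower `P_j ∈ Γ(L, Sym^j(T_L[-n]))`, `j ≥ 2`, of cohomological degree `n + 1` is an
`(n-1)`-shifted homotopy Poisson structure on the formal moduli problem `L` with cohomological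
vector field `Q` if `[Q + ∑ P_j, Q + ∑ P_j] = 0`. -/
structure IsHomotopyPoisson (Q : VectorField L) (P : ℕ → PolyVec n L) : Prop where
  polyDegree : ∀ j, 2 ≤ j → IsPolyDegree j (P j)
  degree : ∀ j, 2 ≤ j → CSym.IsHomog (n + 1) (P j)
  master : schouten (ofVectorField n Q + tower P) (ofVectorField n Q + tower P) = 0

end PolyVec

/-! ### Regular embedded Lagrangians -/

/-- A Lagrangian `f : 𝔩₊ → 𝔤` (injective, with `ω` vanishing on `𝔩₊`) and a complementary graded
subspace `g : 𝔩₋ → 𝔤` on which `ω` vanishes too. -/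
structure LagrangianSplitting {G : GrSpace.{u, v} k} {n : ℤ} (ω : ShiftedSymplectic G n)
    (Lp : GrSpace.{u, w} k) (Lm : GrSpace.{u, x} k) where
  f : GrHom Lp G
  f_injective : Function.Injective f.lin
  f_isotropic : ∀ a b, ω.form (f.lin a) (f.lin b) = 0
  g : GrHom Lm G
  g_injective : Function.Injective g.lin
  g_isotropic : ∀ a b, ω.form (g.lin a) (g.lin b) = 0
  isCompl : IsCompl (LinearMap.range f.lin) (LinearMap.range g.lin)

namespace LagrangianSplitting

variable {G : GrSpace.{u, v} k} {n : ℤ} {ω : ShiftedSymplectic G n} {Lp : GrSpace.{u, w} k}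
  {Lm : GrSpace.{u, x} k}

/-- The decomposition `𝔩₊ ⊕ 𝔩₋ → 𝔤`. -/
def sumHom (D : LagrangianSplitting ω Lp Lm) : GrHom (Lp.prod Lm) G := D.f.coprod D.g

lemma sumHom_bijective (D : LagrangianSplitting ω Lp Lm) : Function.Bijective D.sumHom.lin := by
  constructor
  · rw [← LinearMap.ker_eq_bot, LinearMap.ker_eq_bot']
    rintro ⟨a, b⟩ h
    have h' : D.f.lin a + D.g.lin b = 0 := h
    have h1 : D.f.lin a ∈ LinearMap.range D.g.lin :=
      ⟨-b, by rw [map_neg]; exact (eq_neg_of_add_eq_zero_left h').symm⟩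
    have h2 : D.f.lin a = 0 := Submodule.disjoint_def.1 D.isCompl.disjoint _ ⟨a, rfl⟩ h1
    rw [h2, zero_add] at h'
    rw [D.f_injective (h2.trans (map_zero _).symm), D.g_injective (h'.trans (map_zero _).symm)]
    rfl
  · intro y
    have : y ∈ LinearMap.range D.f.lin ⊔ LinearMap.range D.g.lin := by
      rw [D.isCompl.sup_eq_top]; trivial
    obtain ⟨_, ⟨a, rfl⟩, _, ⟨b, rfl⟩, rfl⟩ := Submodule.mem_sup.1 this
    exact ⟨(a, b), rfl⟩

/-- The inverse `𝔤 → 𝔩₊ ⊕ 𝔩₋`. -/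
def split (D : LagrangianSplitting ω Lp Lm) : GrHom G (Lp.prod Lm) :=
  D.sumHom.inverse D.sumHom_bijective

lemma split_sumHom (D : LagrangianSplitting ω Lp Lm) (a : Lp) (b : Lm) :
    D.split.lin (D.f.lin a + D.g.lin b) = (a, b) :=
  (LinearEquiv.ofBijective D.sumHom.lin D.sumHom_bijective).symm_apply_apply (a, b)

lemma shifted_isotropic (ω : ShiftedSymplectic G n) {L : GrSpace.{u, w} k} (f : GrHom L G)
    (h : ∀ a b, ω.form (f.lin a) (f.lin b) = 0) (a b : L) :
    ω.shifted (f.lin a) (f.lin b) = 0 := by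
  refine L.induction_gr (p := fun a => ω.shifted (f.lin a) (f.lin b) = 0) a ?_ (by simp) ?_
  · intro d c hc
    rw [ShiftedSymplectic.shifted, LinearMap.comp_apply, GrSpace.sgn,
      diag_of_mem G _ (f.map_gr d c hc), map_smul]
    simp [h]
  · intro c c' hc hc'
    simp [hc, hc']

/-- The linear map `𝔩₊*[-1] ⊕ 𝔩₊[1-n] → 𝔤*[-1]` dual to the isomorphism `𝔤 ≅ 𝔩₊ ⊕ 𝔩₊*[n-2]`
given by the splitting and by `ω|_{𝔩₋} : 𝔩₋ → 𝔩₊*[n-2]`: the pair `(ξ, a)` is sent to the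
functional `(y₊, y₋) ↦ ξ(y₊) + Ω(y₋, a)`. -/
def coordHom (D : LagrangianSplitting ω Lp Lm) :
    GrHom ((Lp.shift 1).dual.prod (Lp.shift (1 - n))) (G.shift 1).dual where
  lin := LinearMap.coprod
    ((LinearMap.fst k Lp Lm ∘ₗ D.split.lin).dualMap)
    ((ω.shifted ∘ₗ D.g.lin ∘ₗ LinearMap.snd k Lp Lm ∘ₗ D.split.lin).flip ∘ₗ D.f.lin)
  map_gr := by
    rintro d ⟨ξ, a⟩ ⟨hξ, ha⟩ e he y hy
    have hs := D.split.map_gr (e + 1) y hy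
    have h1 : ξ (D.split.lin y).1 = 0 := hξ e he _ hs.1
    have h2 : ω.shifted (D.g.lin (D.split.lin y).2) (D.f.lin a) = 0 := by
      have hg := D.g.map_gr _ _ hs.2
      rw [ShiftedSymplectic.shifted, LinearMap.comp_apply, GrSpace.sgn, diag_of_mem G _ hg,
        map_smul, LinearMap.smul_apply, LinearEquiv.coe_coe,
        ω.degree _ _ _ hg _ (D.f.map_gr _ _ ha) (by omega), smul_zero]
    change ξ (D.split.lin y).1 + ω.shifted (D.g.lin (D.split.lin y).2) (D.f.lin a) = 0
    rw [h1, h2, add_zero]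

lemma coordHom_apply (D : LagrangianSplitting ω Lp Lm) (ξ : Module.Dual k Lp) (a : Lp) (y : G) :
    (D.coordHom.lin (ξ, a) : Module.Dual k G) y
      = ξ (D.split.lin y).1 + ω.shifted (D.g.lin (D.split.lin y).2) (D.f.lin a) := rfl

lemma shifted_left_injective (ω : ShiftedSymplectic G n) (z : G)
    (h : ∀ y, ω.shifted y z = 0) : z = 0 := by
  have h' : ∀ d, ∀ y ∈ G.gr d, ω.form y z = 0 := by
    intro d y hy
    have := h y
    rw [ShiftedSymplectic.shifted, LinearMap.comp_apply, GrSpace.sgn, diag_of_mem G _ hy,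
      map_smul, LinearMap.smul_apply, LinearEquiv.coe_coe, smul_eq_mul] at this
    refine (mul_eq_zero.1 this).resolve_left ?_
    rcases Int.even_or_odd (1 * d) with hd | hd
    · rw [ksign_of_even hd]; exact one_ne_zero
    · rw [ksign_of_odd hd]; exact neg_ne_zero.2 one_ne_zero
  have h2 : ∀ y, ω.form y z = 0 := fun y =>
    G.induction_gr (p := fun y => ω.form y z = 0) y h' (by simp) (fun b c hb hc => by simp [hb, hc])
  refine (Module.forall_dual_apply_eq_zero_iff k z).1 fun φ => ?_
  simpa using h2 (ω.form.symm φ)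

lemma coordHom_bijective (D : LagrangianSplitting ω Lp Lm) :
    Function.Bijective D.coordHom.lin := by
  have hf : ∀ a, D.split.lin (D.f.lin a) = (a, 0) := fun a => by
    simpa using D.split_sumHom a 0
  have hg : ∀ b, D.split.lin (D.g.lin b) = (0, b) := fun b => by
    simpa using D.split_sumHom 0 b
  have hff := shifted_isotropic ω D.f D.f_isotropic
  have hgg := shifted_isotropic ω D.g D.g_isotropic
  have hdec : ∀ y, y = D.f.lin (D.split.lin y).1 + D.g.lin (D.split.lin y).2 := fun y =>
    ((LinearEquiv.ofBijective D.sumHom.lin D.sumHom_bijective).apply_symm_apply y).symm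
  constructor
  · rw [← LinearMap.ker_eq_bot, LinearMap.ker_eq_bot']
    rintro ⟨ξ, a⟩ h
    have h' : ∀ y, ξ (D.split.lin y).1 + ω.shifted (D.g.lin (D.split.lin y).2) (D.f.lin a) = 0 :=
      fun y => by rw [← D.coordHom_apply, h]; rfl
    have h1 : ξ = 0 := LinearMap.ext fun b => by simpa [hf] using h' (D.f.lin b)
    have h2 : D.f.lin a = 0 := by
      refine shifted_left_injective ω _ fun y => ?_
      rw [hdec y, map_add, LinearMap.add_apply, hff, zero_add]
      simpa [h1] using h' y
    rw [h1, D.f_injective (h2.trans (map_zero _).symm)]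
    rfl
  · intro φ
    let φ' : Module.Dual k G := φ - D.coordHom.lin (φ.comp D.f.lin, 0)
    have hinj : Function.Injective (ω.shifted.flip) := by
      rw [← LinearMap.ker_eq_bot, LinearMap.ker_eq_bot']
      intro z hz
      exact shifted_left_injective ω z fun y => by
        rw [← LinearMap.flip_apply, hz]; rfl
    have hsurj := (LinearMap.injective_iff_surjective_of_finrank_eq_finrank
      (Subspace.dual_finrank_eq (K := k) (V := G)).symm).1 hinj
    obtain ⟨z, hz⟩ := hsurj φ'
    have hz' : ∀ y, ω.shifted y z = φ y - φ (D.f.lin (D.split.lin y).1) := fun y => by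
      rw [← LinearMap.flip_apply, hz]
      change φ y - (D.coordHom.lin (φ.comp D.f.lin, 0) : Module.Dual k G) y = _
      rw [coordHom_apply]; simp
    have hm : D.g.lin (D.split.lin z).2 = 0 := by
      refine shifted_left_injective ω _ fun y => ?_
      rw [hdec y, map_add, LinearMap.add_apply, hgg, add_zero]
      have := hz' (D.f.lin (D.split.lin y).1)
      rw [hdec z, map_add, hff, zero_add] at this
      rw [this, hf, sub_self]
    refine ⟨(φ.comp D.f.lin, (D.split.lin z).1), LinearMap.ext fun y => ?_⟩
    rw [coordHom_apply]
    have h3 : D.f.lin (D.split.lin z).1 = z := by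
      conv_rhs => rw [hdec z, hm, add_zero]
    rw [h3, hz', hg]
    have := hdec y
    simp only [map_zero, sub_zero]
    conv_rhs => rw [this]
    simp

/-- The identification of `O(X) = Sym^(𝔤*[-1])` with the polyvector fields
`Sym^(𝔩₊*[-1]) ⊗^ Sym^(𝔩₊[1-n])` on `L₊`, induced by `𝔤 ≅ 𝔩₊ ⊕ 𝔩₊*[n-2]`. -/
def toPolyVec (D : LagrangianSplitting ω Lp Lm) : Fun G →ₗ[k] PolyVec n Lp :=
  CSym.map (D.coordHom.inverse D.coordHom_bijective)

end LagrangianSplitting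

end Formal

end

/-! The action of a vector field, `Q(F) = ∑ Q(x^i) ∂F/∂x^i`, is a contraction with the identity of
`𝔤`, so it may be computed from any resolution `∑ ξ_j ⊗ y_j` of that identity
(`VectorField.act_eq_sum`). The symplectic form pairs `𝔩₋` perfectly with `𝔩₊`. A basis `e_i` of
`𝔩₊` with its dual basis `b_i` of `𝔩₋` therefore gives Darboux coordinates, in which the Poisson
bracket is, summand by summand, the Schouten bracket (`toPolyVec_bracket`). As `toPolyVec` is
injective, the two master equations are equivalent for every function.

The master equation for `S` follows from `Q² = 0` (`bracket_self_eq_zero`). Since `S ∂_y` is the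
value of `Q` on the coordinate `Ω(y, ·)`, `Q` kills every first derivative of `S`. With the Euler
field `E = ∑ x^i ∂_i`, the Leibniz rule gives `{S, E S} = {S, S}`. The bracket lowers polynomial
degree by two and is symmetric on functions of degree `n + 1`, so `E {S, S} + 2 {S, S} = 2 {S, E
S}`. Hence `E {S, S} = 0`, and in characteristic zero `{S, S}` is constant. The constant is zero
because `S` has no linear term.

The part `S_0` is the restriction of `S` to `L₊`. Strictness of the inclusion identifies the
restriction of `S ∂_y` with the value of `Q_{𝔩₊}` on the restriction of `Ω(y, ·)`
(`IsStrictMap.pullback_apply`). For `y` in `𝔩₊` this functional is zero by isotropy, so all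
derivatives of `S|_{L₊}` vanish, and so does `S|_{L₊}`, again by Euler's identity
(`pullback_eq_zero`). For `y = b_i` in `𝔩₋` it is the coordinate dual to `e_i`, so the fibre
derivatives of `S` along the zero section are the components of `Q_{𝔩₊}`. These derivatives
determine `S_1` (`component_one_toPolyVec`). -/

noncomputable section

open GrSpace

/-! ### Signs, homogeneous bases, and resolutions of the identity. -/

namespace GrSpace

variable {k : Type u} [Field k]

lemma ksign_add (a b : ℤ) : ksign k (a + b) = ksign k a * ksign k b := by
  simp [ksign, Int.negOnePow_add]

lemma ksign_congr {a b : ℤ} (h : Even (a - b)) : ksign k a = ksign k b := by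
  rw [ksign, ksign, (Int.negOnePow_eq_iff a b).2 h]

lemma ksign_mul_self (a : ℤ) : ksign k a * ksign k a = 1 := by
  rw [← ksign_add, ksign_of_even ⟨a, rfl⟩]

lemma map_diag {A : GrSpace.{u, v} k} {B : GrSpace.{u, w} k} (f : GrHom A B) (c : ℤ → k) (a : A) :
    f.lin (A.diag c a) = B.diag c (f.lin a) := by
  refine A.induction_gr (p := fun a => f.lin (A.diag c a) = B.diag c (f.lin a)) a ?_ (by simp) ?_
  · intro d b hb
    rw [diag_of_mem A c hb, diag_of_mem B c (f.map_gr d b hb), map_smul]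
  · intro b b' hb hb'
    simp only [map_add, hb, hb']

lemma parity_add_parity (A : GrSpace.{u, v} k) (a : A) : A.parity 0 a + A.parity 1 a = a := by
  refine A.induction_gr (p := fun a => A.parity 0 a + A.parity 1 a = a) a ?_ (by simp) ?_
  · intro d b hb
    rw [parity, parity, diag_of_mem A _ hb, diag_of_mem A _ hb]
    by_cases h : Even d
    · simp [h]
    · simp [h]
  · intro b c hb hc
    rw [map_add, map_add, add_add_add_comm, hb, hc]

/-- A functional of degree `d` kills the part of parity different from that of `d`. -/
lemma apply_parity_eq_zero {A : GrSpace.{u, v} k} {d : ℤ} {φ : Module.Dual k A}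
    (hφ : φ ∈ A.dual.gr d) {ε : ℤ} (h : ¬ Even (d + ε)) (a : A) : φ (A.parity ε a) = 0 := by
  refine A.induction_gr (p := fun a => φ (A.parity ε a) = 0) a ?_ (by simp) ?_
  · intro e b hb
    rw [parity, diag_of_mem A _ hb]
    by_cases he : e = -d
    · subst he
      rw [if_neg (by grind), zero_smul, map_zero]
    · rw [map_smul, hφ e he b hb, smul_zero]
  · intro b c hb hc
    rw [map_add, map_add, hb, hc, add_zero]

/-- The functional on the dual given by a homogeneous vector. -/
lemma eval_mem_gr {A : GrSpace.{u, v} k} {d : ℤ} {y : A} (hy : y ∈ A.gr d) :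
    Module.Dual.eval k A y ∈ A.dual.dual.gr d := by
  intro e he φ hφ
  exact hφ d (by omega) y hy

lemma exists_homogeneous_basis (A : GrSpace.{u, v} k) :
    ∃ (m : ℕ) (b : Module.Basis (Fin m) k A) (d : Fin m → ℤ), ∀ i, b i ∈ A.gr (d i) := by
  let b := A.internal.collectedBasis fun d => Module.finBasis k (A.gr d)
  have : Fintype (Σ d, Fin (Module.finrank k (A.gr d))) := Module.Basis.fintypeIndexOfRankLtAleph0 b
    (by exact Module.rank_lt_aleph0 k A)
  let e := Fintype.equivFin (Σ d, Fin (Module.finrank k (A.gr d)))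
  refine ⟨_, b.reindex e, fun i => (e.symm i).1, fun i => ?_⟩
  rw [Module.Basis.reindex_apply]
  exact A.internal.collectedBasis_mem _ _

lemma exists_homogeneous_basis_shift (A : GrSpace.{u, v} k) (s : ℤ) :
    ∃ (m : ℕ) (b : Module.Basis (Fin m) k A) (d : Fin m → ℤ), ∀ i, b i ∈ (A.shift s).gr (d i) :=
  (A.shift s).exists_homogeneous_basis

lemma coord_mem_gr {A : GrSpace.{u, v} k} {ι : Type*} (b : Module.Basis ι k A) {d : ι → ℤ}
    (hb : ∀ i, b i ∈ A.gr (d i)) (i : ι) : b.coord i ∈ A.dual.gr (-d i) := by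
  classical
  intro e he a ha
  have h : b.coord i ∘ₗ A.proj e = 0 := by
    refine b.ext fun j => ?_
    rw [LinearMap.comp_apply, A.proj_of_mem (hb j)]
    split_ifs with hj
    · have : j ≠ i := by rintro rfl; exact he (by omega)
      simp [this]
    · simp
  have h2 := LinearMap.congr_fun h a
  rwa [LinearMap.comp_apply, A.proj_of_mem ha, if_pos rfl] at h2

/-- The contraction of a bilinear map with the identity tensor can be computed from any
resolution of the identity. -/
lemma sum_basis_eq_sum_resolution {V : Type v} [AddCommGroup V] [Module k V] {M : Type w}
    [AddCommMonoid M] [Module k M] {ι κ : Type*} [Fintype ι] [Fintype κ] (b : Module.Basis ι k V)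
    (ξ : κ → Module.Dual k V) (y : κ → V) (h : ∀ z, ∑ j, ξ j z • y j = z)
    (B : Module.Dual k V →ₗ[k] V →ₗ[k] M) :
    ∑ i, B (b.coord i) (b i) = ∑ j, B (ξ j) (y j) := by
  -- Both sums equal the double sum of `b.coord i (y j) • B (ξ j) (b i)`: `h1` expands the
  -- coordinates through the resolution, `h2` the vectors through the basis.
  have h1 : ∀ i, b.coord i = ∑ j, b.coord i (y j) • ξ j := fun i => by
    refine LinearMap.ext fun z => ?_
    conv_lhs => rw [← h z]
    simp [LinearMap.sum_apply, mul_comm]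
  have h2 : ∀ j, y j = ∑ i, b.coord i (y j) • b i := fun j => by
    simp
  calc ∑ i, B (b.coord i) (b i) = ∑ i, ∑ j, b.coord i (y j) • B (ξ j) (b i) := by
        refine Finset.sum_congr rfl fun i _ => ?_
        conv_lhs => rw [h1 i]
        simp [LinearMap.sum_apply]
    _ = ∑ j, B (ξ j) (y j) := by
        rw [Finset.sum_comm]
        refine Finset.sum_congr rfl fun j _ => ?_
        conv_rhs => rw [h2 j]
        simp only [map_sum, map_smul]

lemma sum_basis_eq_sum_basis {V : Type v} [AddCommGroup V] [Module k V] {M : Type w}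
    [AddCommMonoid M] [Module k M] {ι κ : Type*} [Fintype ι] [Fintype κ] (b : Module.Basis ι k V)
    (c : Module.Basis κ k V) (B : Module.Dual k V →ₗ[k] V →ₗ[k] M) :
    ∑ i, B (b.coord i) (b i) = ∑ j, B (c.coord j) (c j) :=
  sum_basis_eq_sum_resolution b _ _ (fun z => by simp) B

end GrSpace

/-! ### The graded symmetric algebra: degrees, Koszul signs, derivations. -/

namespace GSym

variable {k : Type u} [Field k] {A : GrSpace.{u, v} k}

/-- Induction on words of homogeneous letters, adding one letter on the left. The motive carries the
degree so that Koszul signs can be followed through the induction. -/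
lemma homog_induction {P : ℤ → GSym A → Prop} (one : P 0 1)
    (mul : ∀ e m, ∀ y ∈ A.gr e, ∀ b ∈ homog A m, P m b → P (e + m) (ι A y * b))
    (zero : ∀ m, P m 0) (add : ∀ m a b, P m a → P m b → P m (a + b))
    (smul : ∀ m (c : k) a, P m a → P m (c • a)) {d : ℤ} {a : GSym A} (ha : a ∈ homog A d) :
    P d a := by
  induction ha using Submodule.span_induction with
  | mem a h =>
    obtain ⟨l, hl, rfl, rfl⟩ := h
    induction l with
    | nil => simpa using one
    | cons y l ih =>
      simp only [List.map_cons, List.sum_cons, List.prod_cons]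
      have hl' : ∀ z ∈ l, z.2 ∈ A.gr z.1 := fun z hz => hl z (List.mem_cons_of_mem _ hz)
      exact mul _ _ _ (hl y List.mem_cons_self) _ (Submodule.subset_span ⟨l, hl', rfl, rfl⟩)
        (ih hl')
  | zero => exact zero _
  | add a b _ _ ha hb => exact add _ _ _ ha hb
  | smul c a _ ha => exact smul _ _ _ ha

lemma one_mem_homog : (1 : GSym A) ∈ homog A 0 :=
  Submodule.subset_span ⟨[], by simp, by simp, by simp⟩

lemma ι_mem_homog {d : ℤ} {y : A} (hy : y ∈ A.gr d) : ι A y ∈ homog A d :=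
  Submodule.subset_span ⟨[(d, y)], by simpa using hy, by simp, by simp⟩

lemma ι_mul_mem_homog {d e : ℤ} {y : A} (hy : y ∈ A.gr d) {b : GSym A} (hb : b ∈ homog A e) :
    ι A y * b ∈ homog A (d + e) := by
  induction hb using Submodule.span_induction with
  | mem b h =>
    obtain ⟨l, hl, rfl, rfl⟩ := h
    refine Submodule.subset_span ⟨(d, y) :: l, ?_, by simp, by simp⟩
    intro z hz
    rcases List.mem_cons.1 hz with rfl | hz
    · exact hy
    · exact hl z hz
  | zero => simp
  | add a b _ _ ha hb => rw [mul_add]; exact add_mem ha hb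
  | smul c a _ ha => rw [mul_smul_comm]; exact Submodule.smul_mem _ _ ha

lemma algebraMap_mem_homog (c : k) : algebraMap k (GSym A) c ∈ homog A 0 := by
  rw [Algebra.algebraMap_eq_smul_one]
  exact Submodule.smul_mem _ _ one_mem_homog

lemma homog_comm {d e : ℤ} {a b : GSym A} (ha : a ∈ homog A d) (hb : b ∈ homog A e) :
    a * b = ksign k (d * e) • (b * a) := by
  have key : ∀ d, ∀ y ∈ A.gr d, ι A y * b = ksign k (d * e) • (b * ι A y) := by
    intro d y hy
    refine homog_induction (P := fun e b => ι A y * b = ksign k (d * e) • (b * ι A y))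
      ?_ ?_ ?_ ?_ ?_ hb
    · simp [ksign]
    · intro e m z hz b _ ih
      rw [← mul_assoc, ι_comm A hy hz, smul_mul_assoc, mul_assoc, ih, mul_smul_comm, smul_smul,
        ← mul_assoc, mul_add, ksign_add]
    · simp
    · intro m a b ha hb
      rw [mul_add, ha, hb, add_mul, smul_add]
    · intro m c a ha
      rw [mul_smul_comm, ha, smul_mul_assoc, smul_comm]
  refine homog_induction (P := fun d a => a * b = ksign k (d * e) • (b * a)) ?_ ?_ ?_ ?_ ?_ ha
  · simp [ksign]
  · intro d m y hy a _ ih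
    rw [mul_assoc, ih, mul_smul_comm, ← mul_assoc, key d y hy, smul_mul_assoc, smul_smul,
      mul_assoc, add_mul, ksign_add, mul_comm]
  · simp
  · intro m a b ha hb
    rw [add_mul, ha, hb, mul_add, smul_add]
  · intro m c a ha
    rw [smul_mul_assoc, ha, mul_smul_comm, smul_comm]

lemma map_ι {B : GrSpace.{u, w} k} (f : GrHom A B) (a : A) : map f (ι A a) = ι B (f.lin a) :=
  lift_ι _ _ a

lemma map_mem_homog {B : GrSpace.{u, w} k} (f : GrHom A B) {d : ℤ} {a : GSym A}
    (ha : a ∈ homog A d) : map f a ∈ homog B d := by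
  refine homog_induction (P := fun d a => map f a ∈ homog B d) ?_ ?_ ?_ ?_ ?_ ha
  · rw [map_one]; exact one_mem_homog
  · intro e m y hy b _ ih
    rw [map_mul, map_ι]
    exact ι_mul_mem_homog (f.map_gr e y hy) ih
  · simp
  · intro m a b ha hb
    rw [map_add]; exact add_mem ha hb
  · intro m c a ha
    rw [map_smul]; exact Submodule.smul_mem _ _ ha

/-- An algebra map out of `Sym(A)` is determined on generators. -/
lemma algHom_ext {R : Type w} [Ring R] [Algebra k R] {f g : GSym A →ₐ[k] R}
    (h : ∀ y, f (ι A y) = g (ι A y)) : f = g := by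
  refine AlgHom.ext fun a => ?_
  induction a using GSym.induction with
  | hc r => rw [AlgHom.commutes, AlgHom.commutes]
  | hι y => exact h y
  | hm b c hb hc => rw [map_mul, map_mul, hb, hc]
  | ha b c hb hc => rw [map_add, map_add, hb, hc]

/-! #### Derivations -/

lemma contract_algebraMap (i j : ℤ) (φ : Module.Dual k A) (r : k) :
    contract A i j φ (algebraMap k _ r) = 0 := by
  simp [contract, Matrix.algebraMap_matrix_apply]

lemma contract_ι (i j : ℤ) (φ : Module.Dual k A) (y : A) :
    contract A i j φ (ι A y) = algebraMap k _ (φ (A.parity (i + j) y)) := by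
  simp [contract, contractHom_ι]

/-- `leftDeriv` and `rightDeriv` are sums of an even and an odd contraction. For a homogeneous
functional this lemma discards the one of the wrong parity. -/
lemma contract_eq_zero {i j : ℤ} {φ : Module.Dual k A}
    (h : ∀ y, φ (A.parity (i + j) y) = 0) : contract A i j φ = 0 := by
  refine LinearMap.ext fun a => ?_
  induction a using GSym.induction with
  | hc r => rw [contract_algebraMap]; rfl
  | hι y => rw [contract_ι, h, map_zero]; rfl
  | hm b c hb hc => rw [contract_mul, hb, hc]; simp
  | ha b c hb hc => rw [map_add, hb, hc]; simp

/-- The diagonal entries are powers of the parity involution, hence signs on homogeneous elements.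
This turns the twisted rule `contract_mul` into the Koszul rule. -/
lemma contractHom_of_homog (i j : ℤ) {m : ℤ} {a : GSym A} (ha : a ∈ homog A m) :
    contractHom A i j 0 a 0 0 = ksign k (i * m) • a ∧
      contractHom A i j 0 a 1 1 = ksign k (j * m) • a := by
  refine homog_induction (P := fun m a => contractHom A i j 0 a 0 0 = ksign k (i * m) • a ∧
      contractHom A i j 0 a 1 1 = ksign k (j * m) • a) ?_ ?_ ?_ ?_ ?_ ha
  · simp [ksign]
  · intro e m y hy b _ ih
    have hs : ∀ i : ℤ, A.sgn i y = ksign k (i * e) • y := fun i => diag_of_mem A _ hy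
    simp [Matrix.mul_apply, Fin.sum_univ_two, contractHom_ι, hs, ih.1, ih.2,
      mul_add, ksign_add, smul_smul, (contractHom_indep A i j 0 0 b).2.2.1, mul_comm]
  · simp
  · intro m a b ha hb
    simp [ha.1, ha.2, hb.1, hb.2]
  · intro m c a ha
    simp [ha.1, ha.2, smul_comm c]

lemma contract_map {B : GrSpace.{u, w} k} (f : GrHom A B) (i j : ℤ) (φ : Module.Dual k B)
    (a : GSym A) : contract B i j φ (map f a) = map f (contract A i j (φ ∘ₗ f.lin) a) := by
  have hh : ∀ a : GSym A, contractHom B i j 0 (map f a) 0 0 = map f (contractHom A i j 0 a 0 0) ∧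
      contractHom B i j 0 (map f a) 1 1 = map f (contractHom A i j 0 a 1 1) := by
    intro a
    induction a using GSym.induction with
    | hc r => simp [Matrix.algebraMap_matrix_apply]
    | hι y => simp [contractHom_ι, map_ι, GrSpace.sgn, map_diag]
    | hm b c hb hc =>
      have h1 := (contractHom_indep A i j 0 0 b).2.2.1
      have h2 := (contractHom_indep B i j 0 0 (map f b)).2.2.1
      have h3 := (contractHom_indep A i j 0 0 c).2.2.1
      have h4 := (contractHom_indep B i j 0 0 (map f c)).2.2.1
      simp [Matrix.mul_apply, Fin.sum_univ_two, hb.1, hb.2, hc.1, hc.2, h1, h2, h3, h4]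
    | ha b c hb hc => simp [hb.1, hb.2, hc.1, hc.2]
  induction a using GSym.induction with
  | hc r => rw [AlgHom.commutes, contract_algebraMap, contract_algebraMap, map_zero]
  | hι y =>
    rw [map_ι, contract_ι, contract_ι, AlgHom.commutes, LinearMap.comp_apply, GrSpace.parity,
      GrSpace.parity, map_diag]
  | hm b c hb hc =>
    rw [map_mul, contract_mul, contract_mul, map_add, map_mul, map_mul, hb, hc, (hh b).1, (hh c).2]
  | ha b c hb hc => simp only [map_add, hb, hc]

lemma leftDeriv_map {B : GrSpace.{u, w} k} (f : GrHom A B) (φ : Module.Dual k B) (a : GSym A) :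
    leftDeriv B φ (map f a) = map f (leftDeriv A (φ ∘ₗ f.lin) a) := by
  simp [leftDeriv, contract_map]

lemma rightDeriv_map {B : GrSpace.{u, w} k} (f : GrHom A B) (φ : Module.Dual k B) (a : GSym A) :
    rightDeriv B φ (map f a) = map f (rightDeriv A (φ ∘ₗ f.lin) a) := by
  simp [rightDeriv, contract_map]

lemma leftDeriv_linear (r : k) (φ ψ : Module.Dual k A) (a : GSym A) :
    leftDeriv A (r • φ + ψ) a = r • leftDeriv A φ a + leftDeriv A ψ a := by
  simp only [leftDeriv, LinearMap.add_apply, contract_linear, smul_add]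
  abel

lemma leftDeriv_ι (φ : Module.Dual k A) (y : A) :
    leftDeriv A φ (ι A y) = algebraMap k _ (φ y) := by
  rw [leftDeriv, LinearMap.add_apply, contract_ι, contract_ι, ← map_add, ← map_add]
  simp [parity_add_parity]

lemma rightDeriv_ι (φ : Module.Dual k A) (y : A) :
    rightDeriv A φ (ι A y) = algebraMap k _ (φ y) := by
  rw [rightDeriv, LinearMap.add_apply, contract_ι, contract_ι, ← map_add, ← map_add]
  simp [parity_add_parity]

lemma leftDeriv_algebraMap (φ : Module.Dual k A) (r : k) :
    leftDeriv A φ (algebraMap k _ r) = 0 := by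
  rw [leftDeriv, LinearMap.add_apply, contract_algebraMap, contract_algebraMap, add_zero]

lemma rightDeriv_algebraMap (φ : Module.Dual k A) (r : k) :
    rightDeriv A φ (algebraMap k _ r) = 0 := by
  rw [rightDeriv, LinearMap.add_apply, contract_algebraMap, contract_algebraMap, add_zero]

/-- Only the contraction whose twist `i` has the parity of `d` survives, and the sign depends on `i`
only through its parity. -/
lemma leftDeriv_mul {d : ℤ} {φ : Module.Dual k A} (hφ : φ ∈ A.dual.gr d) {m : ℤ} {a : GSym A}
    (ha : a ∈ homog A m) (b : GSym A) :
    leftDeriv A φ (a * b) = leftDeriv A φ a * b + ksign k (d * m) • (a * leftDeriv A φ b) := by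
  have h1 : ∀ i : ℤ, contract A i 0 φ (a * b)
      = contract A i 0 φ a * b + ksign k (i * m) • (a * contract A i 0 φ b) := by
    intro i
    have hb : contractHom A i 0 0 b 1 1 = b := by
      induction b using GSym.induction with
      | hc r => simp [Matrix.algebraMap_matrix_apply]
      | hι y =>
        simp only [contractHom_ι, Matrix.of_apply, Matrix.cons_val', Matrix.cons_val_one,
          Matrix.cons_val_fin_one]
        congr 1
        refine A.induction_gr (p := fun y => A.sgn 0 y = y) y ?_ (by simp) ?_
        · intro d b hb
          rw [sgn, diag_of_mem A _ hb]; simp [ksign]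
        · intro b c hb hc
          rw [map_add, hb, hc]
      | hm b c hb hc =>
        rw [map_mul, Matrix.mul_apply, Fin.sum_univ_two, hb, hc,
          (contractHom_indep A i 0 0 0 b).2.2.1, zero_mul, zero_add]
      | ha b c hb hc => simp [hb, hc]
    rw [contract_mul, hb, (contractHom_of_homog i 0 ha).1, smul_mul_assoc, add_comm]
  rcases Int.even_or_odd d with hd | hd
  · have h0 : contract A 1 0 φ = 0 := contract_eq_zero (apply_parity_eq_zero hφ (by grind))
    rw [leftDeriv, h0, add_zero, h1 0, ksign_of_even (hd.mul_right m)]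
    simp [ksign]
  · have h0 : contract A 0 0 φ = 0 := contract_eq_zero (apply_parity_eq_zero hφ (by grind))
    rw [leftDeriv, h0, zero_add, h1 1, ksign_congr (k := k) (a := 1 * m) (b := d * m)]
    rw [← sub_mul]
    exact (odd_one.sub_odd hd).mul_right m

lemma rightDeriv_mul {d : ℤ} {φ : Module.Dual k A} (hφ : φ ∈ A.dual.gr d) {m : ℤ} (a : GSym A)
    {b : GSym A} (hb : b ∈ homog A m) :
    rightDeriv A φ (a * b) = a * rightDeriv A φ b + ksign k (d * m) • (rightDeriv A φ a * b) := by
  have h1 : ∀ i : ℤ, contract A 0 i φ (a * b)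
      = a * contract A 0 i φ b + ksign k (i * m) • (contract A 0 i φ a * b) := by
    intro i
    have ha : contractHom A 0 i 0 a 0 0 = a := by
      induction a using GSym.induction with
      | hc r => simp [Matrix.algebraMap_matrix_apply]
      | hι y =>
        simp only [contractHom_ι, Matrix.of_apply, Matrix.cons_val', Matrix.cons_val_zero,
          Matrix.cons_val_fin_one]
        congr 1
        refine A.induction_gr (p := fun y => A.sgn 0 y = y) y ?_ (by simp) ?_
        · intro d b hb
          rw [sgn, diag_of_mem A _ hb]; simp [ksign]
        · intro b c hb hc
          rw [map_add, hb, hc]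
      | hm b c hb hc =>
        rw [map_mul, Matrix.mul_apply, Fin.sum_univ_two, hb, hc,
          (contractHom_indep A 0 i 0 0 c).2.2.1, mul_zero, add_zero]
      | ha b c hb hc => simp [hb, hc]
    rw [contract_mul, ha, (contractHom_of_homog 0 i hb).2, mul_smul_comm]
  rcases Int.even_or_odd d with hd | hd
  · have h0 : contract A 0 1 φ = 0 := contract_eq_zero (apply_parity_eq_zero hφ (by grind))
    rw [rightDeriv, h0, add_zero, h1 0, ksign_of_even (hd.mul_right m)]
    simp [ksign]
  · have h0 : contract A 0 0 φ = 0 := contract_eq_zero (apply_parity_eq_zero hφ (by grind))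
    rw [rightDeriv, h0, zero_add, h1 1, ksign_congr (k := k) (a := 1 * m) (b := d * m)]
    rw [← sub_mul]
    exact (odd_one.sub_odd hd).mul_right m

lemma leftDeriv_mem_homog {d : ℤ} {φ : Module.Dual k A} (hφ : φ ∈ A.dual.gr d) {m : ℤ}
    {a : GSym A} (ha : a ∈ homog A m) : leftDeriv A φ a ∈ homog A (m + d) := by
  refine homog_induction (P := fun m a => leftDeriv A φ a ∈ homog A (m + d)) ?_ ?_ ?_ ?_ ?_ ha
  · rw [← map_one (algebraMap k (GSym A)), leftDeriv_algebraMap]; exact zero_mem _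
  · intro e m y hy b hb ih
    rw [leftDeriv_mul hφ (ι_mem_homog hy), leftDeriv_ι]
    refine add_mem ?_ (Submodule.smul_mem _ _ ?_)
    · by_cases he : e = -d
      · subst he
        rw [← Algebra.smul_def, show -d + m + d = m by ring]
        exact Submodule.smul_mem _ _ hb
      · rw [hφ e he y hy, map_zero, zero_mul]; exact zero_mem _
    · rw [add_assoc]; exact ι_mul_mem_homog hy ih
  · simp
  · intro m a b ha hb
    rw [map_add]; exact add_mem ha hb
  · intro m c a ha
    rw [map_smul]; exact Submodule.smul_mem _ _ ha

/-- The letter hit by `φ` has degree `-d`. Extracting it on the other side moves it past the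
remaining letters, of total degree `m + d`, and `d (m + d)` has the parity of `d (m + 1)`. -/
lemma leftDeriv_eq_rightDeriv {d : ℤ} {φ : Module.Dual k A} (hφ : φ ∈ A.dual.gr d) {m : ℤ}
    {a : GSym A} (ha : a ∈ homog A m) :
    leftDeriv A φ a = ksign k (d * (m + 1)) • rightDeriv A φ a := by
  refine homog_induction (P := fun m a => leftDeriv A φ a
    = ksign k (d * (m + 1)) • rightDeriv A φ a) ?_ ?_ ?_ ?_ ?_ ha
  · rw [← map_one (algebraMap k (GSym A)), leftDeriv_algebraMap, rightDeriv_algebraMap, smul_zero]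
  · intro e m y hy b hb ih
    rw [leftDeriv_mul hφ (ι_mem_homog hy), leftDeriv_ι, rightDeriv_mul hφ _ hb, rightDeriv_ι, ih,
      mul_smul_comm, smul_smul, smul_add, smul_smul, ← ksign_add, ← ksign_add, add_comm,
      ← mul_add, ← add_assoc]
    congr 1
    -- In the term where `φ` hits `y`, either `φ y = 0` for degree reasons or `e = -d`, and then the
    -- total sign is even.
    by_cases he : e = -d
    · subst he
      rw [ksign_of_even, one_smul]
      simp only [Int.even_add, Int.even_mul, even_neg, Int.not_even_one]
      tauto
    · rw [hφ e he y hy, map_zero, zero_mul, smul_zero]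
  · simp
  · intro m a b ha hb
    rw [map_add, map_add, ha, hb, smul_add]
  · intro m c a ha
    rw [map_smul, map_smul, ha, smul_comm]

lemma rightDeriv_mem_homog {d : ℤ} {φ : Module.Dual k A} (hφ : φ ∈ A.dual.gr d) {m : ℤ}
    {a : GSym A} (ha : a ∈ homog A m) : rightDeriv A φ a ∈ homog A (m + d) := by
  have h : rightDeriv A φ a = ksign k (d * (m + 1)) • leftDeriv A φ a := by
    rw [leftDeriv_eq_rightDeriv hφ ha, smul_smul, ksign_mul_self, one_smul]
  rw [h]
  exact Submodule.smul_mem _ _ (leftDeriv_mem_homog hφ ha)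

lemma map_map_of_eq {B : GrSpace.{u, w} k} {C : GrSpace.{u, x} k} (f : GrHom A B) (g : GrHom B C)
    (h : GrHom A C) (hh : ∀ y, g.lin (f.lin y) = h.lin y) (a : GSym A) :
    map g (map f a) = map h a := by
  have : (map g).comp (map f) = map h := algHom_ext fun y => by simp [map_ι, hh]
  exact DFunLike.congr_fun this a

lemma map_eq_self (f : GrHom A A) (hf : ∀ y, f.lin y = y) (a : GSym A) : map f a = a := by
  have : map f = AlgHom.id k (GSym A) := algHom_ext fun y => by simp [map_ι, hf]
  exact DFunLike.congr_fun this a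

/-- Euler's identity for the polynomial degree. -/
lemma euler_identity {κ : Type*} [Fintype κ] (c : κ → A) (e : κ → ℤ)
    (hc : ∀ i, c i ∈ A.gr (e i)) (φ : κ → Module.Dual k A) (hφ : ∀ i, φ i ∈ A.dual.gr (-e i))
    (hres : ∀ y, ∑ i, φ i y • c i = y) (p : ℕ) {a : GSym A} (ha : a ∈ pow A p) :
    ∑ i, ι A (c i) * leftDeriv A (φ i) a = (p : k) • a := by
  unfold pow at ha
  induction ha using Submodule.pow_induction_on_left' with
  | algebraMap r => simp [leftDeriv_algebraMap]
  | add b b' p hb hb' ihb ihb' =>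
    simp only [map_add, mul_add, Finset.sum_add_distrib, ihb, ihb', smul_add]
  | mem_mul m hm p b hb ih =>
    obtain ⟨y, rfl⟩ := hm
    refine A.induction_gr (p := fun y => ∑ i, ι A (c i) * leftDeriv A (φ i) (ι A y * b)
      = ((p + 1 : ℕ) : k) • (ι A y * b)) y ?_ (by simp) ?_
    · intro d y hy
      have h1 : ∀ i, ι A (c i) * leftDeriv A (φ i) (ι A y * b)
          = ι A (φ i y • c i) * b + ι A y * (ι A (c i) * leftDeriv A (φ i) b) := by
        intro i
        rw [leftDeriv_mul (hφ i) (ι_mem_homog hy), leftDeriv_ι, mul_add, ← mul_assoc,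
          ← Algebra.commutes, ← Algebra.smul_def, map_smul, mul_smul_comm, ← mul_assoc,
          ι_comm A (hc i) hy, smul_mul_assoc, smul_mul_assoc, smul_smul, ← ksign_add,
          ksign_of_even, one_smul, mul_assoc]
        -- The Leibniz sign has exponent `-e i * d`, and commuting `c i` past `y` contributes `e i *
        -- d`.
        exact ⟨0, by ring⟩
      simp only [h1, Finset.sum_add_distrib]
      rw [← Finset.sum_mul, ← map_sum, hres, ← Finset.mul_sum, ih, mul_smul_comm]
      push_cast
      rw [add_smul, one_smul, add_comm]
    · intro y z hy hz
      simp only [map_add, add_mul, mul_add, Finset.sum_add_distrib, hy, hz, smul_add]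

end GSym

/-! ### The completed symmetric algebra, one symmetric power at a time. -/

namespace CSym

variable {k : Type u} [Field k] {A : GrSpace.{u, v} k} {B : GrSpace.{u, w} k}

lemma ext_coeff {F G : CSym A} (h : ∀ p, coeff p F = coeff p G) : F = G :=
  Subtype.ext (PowerSeries.ext h)

lemma coeff_mem_pow (p : ℕ) (F : CSym A) : coeff p F ∈ GSym.pow A p := F.2 p

lemma coeff_ofCoeff (c : ℕ → GSym A) (hc : ∀ p, c p ∈ GSym.pow A p) (p : ℕ) :
    coeff p (ofCoeff c hc) = c p := PowerSeries.coeff_mk _ _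

lemma coeff_zero (p : ℕ) : coeff p (0 : CSym A) = 0 := rfl

lemma coeff_add (p : ℕ) (F G : CSym A) : coeff p (F + G) = coeff p F + coeff p G := rfl

lemma coeff_smul (p : ℕ) (c : k) (F : CSym A) : coeff p (c • F) = c • coeff p F := rfl

lemma coeff_sum (p : ℕ) {κ : Type*} (s : Finset κ) (F : κ → CSym A) :
    coeff p (∑ i ∈ s, F i) = ∑ i ∈ s, coeff p (F i) := by
  classical
  induction s using Finset.induction_on with
  | empty => rfl
  | insert i s hi ih => rw [Finset.sum_insert hi, Finset.sum_insert hi, coeff_add, ih]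

lemma coeff_mul (p : ℕ) (F G : CSym A) :
    coeff p (F * G) = ∑ q ∈ Finset.HasAntidiagonal.antidiagonal p, coeff q.1 F * coeff q.2 G :=
  PowerSeries.coeff_mul _ _ _

lemma coeff_extend (s : ℕ) (T : GSym A →ₗ[k] GSym B)
    (hT : ∀ p, ∀ a ∈ GSym.pow A (p + s), T a ∈ GSym.pow B p) (p : ℕ) (F : CSym A) :
    coeff p (extend s T hT F) = T (coeff (p + s) F) :=
  coeff_ofCoeff (fun p => T (coeff (p + s) F)) (fun p => hT p _ (F.2 (p + s))) p

lemma coeff_map (f : GrHom A B) (p : ℕ) (F : CSym A) :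
    coeff p (map f F) = GSym.map f (coeff p F) := coeff_extend _ _ _ _ _

lemma coeff_leftDeriv (φ : Module.Dual k A) (p : ℕ) (F : CSym A) :
    coeff p (leftDeriv φ F) = GSym.leftDeriv A φ (coeff (p + 1) F) := coeff_extend _ _ _ _ _

lemma coeff_rightDeriv (φ : Module.Dual k A) (p : ℕ) (F : CSym A) :
    coeff p (rightDeriv φ F) = GSym.rightDeriv A φ (coeff (p + 1) F) := coeff_extend _ _ _ _ _

lemma coeff_zero_gen_mul (y : A) (F : CSym A) : coeff 0 (gen A y * F) = 0 := by
  simp [coeff_mul, gen, coeff_ofCoeff]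

lemma coeff_succ_gen_mul (y : A) (p : ℕ) (F : CSym A) :
    coeff (p + 1) (gen A y * F) = GSym.ι A y * coeff p F := by
  rw [coeff_mul, Finset.sum_eq_single (1, p)]
  · simp [gen, coeff_ofCoeff]
  · rintro ⟨q, r⟩ hq hne
    have : q ≠ 1 := by
      rintro rfl
      exact hne (by rw [Finset.HasAntidiagonal.mem_antidiagonal] at hq; ext <;> simp; omega)
    simp [gen, coeff_ofCoeff, this]
  · intro h
    exact absurd (Finset.HasAntidiagonal.mem_antidiagonal.2 (by omega)) h

lemma coeff_zero_mul_gen (F : CSym A) (y : A) : coeff 0 (F * gen A y) = 0 := by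
  simp [coeff_mul, gen, coeff_ofCoeff]

lemma coeff_succ_mul_gen (F : CSym A) (y : A) (p : ℕ) :
    coeff (p + 1) (F * gen A y) = coeff p F * GSym.ι A y := by
  rw [coeff_mul, Finset.sum_eq_single (p, 1)]
  · simp [gen, coeff_ofCoeff]
  · rintro ⟨q, r⟩ hq hne
    have : r ≠ 1 := by
      rintro rfl
      exact hne (by rw [Finset.HasAntidiagonal.mem_antidiagonal] at hq; ext <;> simp; omega)
    simp [gen, coeff_ofCoeff, this]
  · intro h
    exact absurd (Finset.HasAntidiagonal.mem_antidiagonal.2 (by omega)) h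

lemma gen_add (y z : A) : gen A (y + z) = gen A y + gen A z := by
  refine ext_coeff fun p => ?_
  rw [coeff_add, gen, gen, gen, coeff_ofCoeff, coeff_ofCoeff, coeff_ofCoeff]
  split_ifs
  · exact map_add _ _ _
  · exact (add_zero _).symm

lemma gen_smul (c : k) (y : A) : gen A (c • y) = c • gen A y := by
  refine ext_coeff fun p => ?_
  rw [coeff_smul, gen, gen, coeff_ofCoeff, coeff_ofCoeff]
  split_ifs
  · exact map_smul _ _ _
  · exact (smul_zero _).symm

lemma add_neg_one_smul (F H : CSym A) : F + (-1 : k) • H = F - H := by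
  module

lemma map_mul (f : GrHom A B) (F G : CSym A) : map f (F * G) = map f F * map f G := by
  refine ext_coeff fun p => ?_
  simp only [coeff_map, coeff_mul, map_sum, _root_.map_mul]

lemma map_map_of_eq {C : GrSpace.{u, x} k} (f : GrHom A B) (g : GrHom B C)
    (h : GrHom A C) (hh : ∀ y, g.lin (f.lin y) = h.lin y) (F : CSym A) :
    map g (map f F) = map h F := by
  refine ext_coeff fun p => ?_
  simp only [coeff_map, GSym.map_map_of_eq f g h hh]

lemma map_eq_self (f : GrHom A A) (hf : ∀ y, f.lin y = y) (F : CSym A) : map f F = F := by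
  refine ext_coeff fun p => ?_
  rw [coeff_map, GSym.map_eq_self f hf]

lemma map_gen (f : GrHom A B) (y : A) : map f (gen A y) = gen B (f.lin y) := by
  refine ext_coeff fun p => ?_
  rw [coeff_map, gen, gen, coeff_ofCoeff, coeff_ofCoeff]
  split_ifs
  · exact GSym.map_ι f y
  · exact map_zero _

lemma leftDeriv_map (f : GrHom A B) (φ : Module.Dual k B) (F : CSym A) :
    leftDeriv φ (map f F) = map f (leftDeriv (φ ∘ₗ f.lin) F) := by
  refine ext_coeff fun p => ?_
  simp only [coeff_leftDeriv, coeff_map, GSym.leftDeriv_map]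

lemma rightDeriv_map (f : GrHom A B) (φ : Module.Dual k B) (F : CSym A) :
    rightDeriv φ (map f F) = map f (rightDeriv (φ ∘ₗ f.lin) F) := by
  refine ext_coeff fun p => ?_
  simp only [coeff_rightDeriv, coeff_map, GSym.rightDeriv_map]

lemma leftDeriv_linear (r : k) (φ ψ : Module.Dual k A) (F : CSym A) :
    leftDeriv (r • φ + ψ) F = r • leftDeriv φ F + leftDeriv ψ F := by
  refine ext_coeff fun p => ?_
  simp only [coeff_leftDeriv, coeff_add, coeff_smul, GSym.leftDeriv_linear]

lemma leftDeriv_add (φ ψ : Module.Dual k A) (F : CSym A) :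
    leftDeriv (φ + ψ) F = leftDeriv φ F + leftDeriv ψ F := by
  simpa using leftDeriv_linear 1 φ ψ F

lemma leftDeriv_smul (r : k) (φ : Module.Dual k A) (F : CSym A) :
    leftDeriv (r • φ) F = r • leftDeriv φ F := by
  have h0 : leftDeriv (0 : Module.Dual k A) F = 0 := by
    simpa using leftDeriv_add (0 : Module.Dual k A) 0 F
  simpa [h0] using leftDeriv_linear r φ 0 F

lemma leftDeriv_gen (φ : Module.Dual k A) (y : A) : leftDeriv φ (gen A y) = φ y • 1 := by
  refine ext_coeff fun p => ?_
  have h1 : coeff p (1 : CSym A) = if p = 0 then 1 else 0 := PowerSeries.coeff_one p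
  rw [coeff_leftDeriv, coeff_smul, h1, gen, coeff_ofCoeff]
  rcases p with _ | p
  · simp [GSym.leftDeriv_ι, Algebra.algebraMap_eq_smul_one]
  · simp

lemma leftDeriv_gen_mul {d : ℤ} {φ : Module.Dual k A} (hφ : φ ∈ A.dual.gr d) {m : ℤ} {y : A}
    (hy : y ∈ A.gr m) (F : CSym A) :
    leftDeriv φ (gen A y * F) = φ y • F + ksign k (d * m) • (gen A y * leftDeriv φ F) := by
  refine ext_coeff fun p => ?_
  rw [coeff_leftDeriv, coeff_succ_gen_mul, GSym.leftDeriv_mul hφ (GSym.ι_mem_homog hy),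
    GSym.leftDeriv_ι, coeff_add, coeff_smul, coeff_smul, ← Algebra.smul_def]
  -- The summand with `gen A y` in front starts in polynomial degree one. In degree zero the
  -- derivative of the constant `coeff 0 F` has to vanish instead.
  rcases p with _ | p
  · have h0 : GSym.leftDeriv A φ (coeff 0 F) = 0 := by
      have := coeff_mem_pow 0 F
      rw [GSym.pow, pow_zero, Submodule.mem_one] at this
      obtain ⟨r, hr⟩ := this
      rw [← hr, GSym.leftDeriv_algebraMap]
    rw [coeff_zero_gen_mul, h0, mul_zero]
  · rw [coeff_succ_gen_mul, coeff_leftDeriv]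

namespace IsHomog

lemma map {d : ℤ} {F : CSym A} (hF : IsHomog d F) (f : GrHom A B) : IsHomog d (CSym.map f F) :=
  fun p => by rw [coeff_map]; exact GSym.map_mem_homog f (hF p)

lemma leftDeriv {d : ℤ} {φ : Module.Dual k A} (hφ : φ ∈ A.dual.gr d) {m : ℤ} {F : CSym A}
    (hF : IsHomog m F) : IsHomog (m + d) (leftDeriv φ F) :=
  fun p => by rw [coeff_leftDeriv]; exact GSym.leftDeriv_mem_homog hφ (hF _)

lemma rightDeriv {d : ℤ} {φ : Module.Dual k A} (hφ : φ ∈ A.dual.gr d) {m : ℤ} {F : CSym A}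
    (hF : IsHomog m F) : IsHomog (m + d) (rightDeriv φ F) :=
  fun p => by rw [coeff_rightDeriv]; exact GSym.rightDeriv_mem_homog hφ (hF _)

lemma gen {d : ℤ} {y : A} (hy : y ∈ A.gr d) : IsHomog d (gen A y) := fun p => by
  rw [CSym.gen, coeff_ofCoeff]
  split_ifs
  · exact GSym.ι_mem_homog hy
  · exact zero_mem _

lemma comm {d e : ℤ} {F G : CSym A} (hF : IsHomog d F) (hG : IsHomog e G) :
    F * G = ksign k (d * e) • (G * F) := by
  refine ext_coeff fun p => ?_
  rw [coeff_smul, coeff_mul, coeff_mul, Finset.smul_sum, ← Finset.Nat.sum_antidiagonal_swap]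
  refine Finset.sum_congr rfl fun q _ => ?_
  exact GSym.homog_comm (hF _) (hG _)

lemma leftDeriv_eq {d : ℤ} {φ : Module.Dual k A} (hφ : φ ∈ A.dual.gr d) {m : ℤ} {F : CSym A}
    (hF : IsHomog m F) :
    CSym.leftDeriv φ F = ksign k (d * (m + 1)) • CSym.rightDeriv φ F := by
  refine ext_coeff fun p => ?_
  rw [coeff_leftDeriv, coeff_smul, coeff_rightDeriv, GSym.leftDeriv_eq_rightDeriv hφ (hF _)]

lemma rightDeriv_eq {d : ℤ} {φ : Module.Dual k A} (hφ : φ ∈ A.dual.gr d) {m : ℤ} {F : CSym A}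
    (hF : IsHomog m F) :
    CSym.rightDeriv φ F = ksign k (d * (m + 1)) • CSym.leftDeriv φ F := by
  rw [leftDeriv_eq hφ hF, smul_smul, ksign_mul_self, one_smul]

/-- The exchange of a single summand behind the symmetry of the Poisson bracket: left and right
derivatives are converted into each other on both factors, which are then commuted. The degrees `d`
and `-d - n` are those of directions paired by a form of degree `n`. -/
lemma rightDeriv_mul_leftDeriv {n d : ℤ}
    {φ ψ : Module.Dual k A} (hφ : φ ∈ A.dual.gr d) (hψ : ψ ∈ A.dual.gr (-d - n)) {S T : CSym A}
    (hS : IsHomog (n + 1) S) (hT : IsHomog (n + 1) T) :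
    CSym.rightDeriv ψ S * CSym.leftDeriv φ T
      = (-ksign k ((n + 1) * d)) • (CSym.rightDeriv φ T * CSym.leftDeriv ψ S) := by
  rw [rightDeriv_eq hψ hS, leftDeriv_eq hφ hT, smul_mul_assoc, mul_smul_comm,
    comm (leftDeriv hψ hS) (rightDeriv hφ hT), smul_smul, smul_smul, ← ksign_add, ← ksign_add,
    ← neg_one_mul (ksign k _), ← ksign_of_odd (k := k) odd_one, ← ksign_add]
  congr 1
  refine ksign_congr ?_
  simp only [Int.even_add, Int.even_sub, Int.even_mul, Int.not_even_one, even_neg]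
  tauto

end IsHomog

/-- The Euler vector field, which multiplies `Sym^p` by `p`. -/
def euler (F : CSym A) : CSym A :=
  ofCoeff (fun p => (p : k) • coeff p F) fun p => Submodule.smul_mem _ _ (coeff_mem_pow p F)

lemma coeff_euler (p : ℕ) (F : CSym A) : coeff p (euler F) = (p : k) • coeff p F :=
  coeff_ofCoeff _ _ _

lemma IsHomog.euler {d : ℤ} {F : CSym A} (hF : IsHomog d F) : IsHomog d (euler F) :=
  fun p => by rw [coeff_euler]; exact Submodule.smul_mem _ _ (hF p)

lemma euler_mul (F G : CSym A) : euler (F * G) = euler F * G + F * euler G := by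
  refine ext_coeff fun p => ?_
  rw [coeff_euler, coeff_add, coeff_mul, coeff_mul, coeff_mul, Finset.smul_sum,
    ← Finset.sum_add_distrib]
  refine Finset.sum_congr rfl fun q hq => ?_
  rw [coeff_euler, coeff_euler, smul_mul_assoc, mul_smul_comm, ← add_smul, ← Nat.cast_add,
    Finset.HasAntidiagonal.mem_antidiagonal.1 hq]

lemma euler_sum {κ : Type*} (s : Finset κ) (F : κ → CSym A) :
    euler (∑ i ∈ s, F i) = ∑ i ∈ s, euler (F i) := by
  refine ext_coeff fun p => ?_
  simp only [coeff_euler, coeff_sum, Finset.smul_sum]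

lemma leftDeriv_euler (φ : Module.Dual k A) (F : CSym A) :
    leftDeriv φ (euler F) = euler (leftDeriv φ F) + leftDeriv φ F := by
  refine ext_coeff fun p => ?_
  simp only [coeff_leftDeriv, coeff_euler, coeff_add, map_smul]
  push_cast
  rw [add_smul, one_smul]

lemma rightDeriv_euler (φ : Module.Dual k A) (F : CSym A) :
    rightDeriv φ (euler F) = euler (rightDeriv φ F) + rightDeriv φ F := by
  refine ext_coeff fun p => ?_
  simp only [coeff_rightDeriv, coeff_euler, coeff_add, map_smul]
  push_cast
  rw [add_smul, one_smul]

/-- In characteristic zero the eigenvalue `p` of the Euler field is invertible for `p > 0`, so only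
constants lie in its kernel. -/
lemma eq_zero_of_euler_eq_zero [CharZero k] {F : CSym A} (h : euler F = 0) (h0 : coeff 0 F = 0) :
    F = 0 := by
  refine ext_coeff fun p => ?_
  rcases p with _ | p
  · exact h0
  · have := congrArg (coeff (p + 1)) h
    rw [coeff_euler, coeff_zero] at this
    exact (smul_eq_zero.1 this).resolve_left (Nat.cast_ne_zero.2 p.succ_ne_zero)

/-- Euler's identity, in linear coordinates. -/
lemma euler_eq_sum (V : GrSpace.{u, v} k) {κ : Type*} [Fintype κ] (b : Module.Basis κ k V)
    {d : κ → ℤ} (hb : ∀ i, b i ∈ V.gr (d i)) (F : CSym V.dual) :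
    euler F = ∑ i, gen V.dual (b.coord i) *
      leftDeriv (A := V.dual) (Module.Dual.eval k V (b i)) F := by
  refine ext_coeff fun p => ?_
  rw [coeff_euler, coeff_sum]
  rcases p with _ | p
  · simp [coeff_zero_gen_mul]
  · simp only [coeff_succ_gen_mul, coeff_leftDeriv]
    refine (GSym.euler_identity (A := V.dual) (fun i => b.coord i) (fun i => -d i)
      (fun i => coord_mem_gr b hb i) (fun i => Module.Dual.eval k V (b i)) (fun i => ?_)
      (fun ξ => ?_) (p + 1) (coeff_mem_pow _ F)).symm
    · rw [neg_neg]; exact eval_mem_gr (hb i)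
    · refine b.ext fun j => ?_
      simp

end CSym

/-! ### Action of vector fields on functions. -/

namespace VectorField

variable {k : Type u} [Field k] {G : GrSpace.{u, v} k}

/-- This allows computation with resolutions of the identity adapted to the symplectic form or to
the Lagrangian splitting. -/
lemma act_eq_sum (Q : VectorField G) (F : Fun G) {κ : Type*} [Fintype κ]
    (ξ : κ → Module.Dual k G) (y : κ → G) (h : ∀ z, ∑ j, ξ j z • y j = z) :
    Q.act F = ∑ j, Q (ξ j) * dirDeriv (y j) F :=
  sum_basis_eq_sum_resolution (Module.finBasis k G) ξ y h
    (LinearMap.mk₂ k (fun (ξ : Module.Dual k G) (y : G) => Q ξ * dirDeriv y F)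
      (fun ξ η y => by rw [map_add, add_mul])
      (fun c ξ y => by rw [map_smul, smul_mul_assoc])
      (fun ξ y z => by rw [dirDeriv, dirDeriv, dirDeriv, map_add, CSym.leftDeriv_add, mul_add])
      (fun c ξ y => by rw [dirDeriv, dirDeriv, map_smul, CSym.leftDeriv_smul, mul_smul_comm]))

lemma act_eq_sum_basis (Q : VectorField G) (F : Fun G) {κ : Type*} [Fintype κ]
    (b : Module.Basis κ k G) : Q.act F = ∑ j, Q (b.coord j) * dirDeriv (b j) F :=
  Q.act_eq_sum F _ _ fun z => by simp

lemma act_smul (Q : VectorField G) (c : k) (F : Fun G) : Q.act (c • F) = c • Q.act F := by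
  simp only [act, map_smul, mul_smul_comm, Finset.smul_sum]

lemma act_sum (Q : VectorField G) {κ : Type*} (s : Finset κ) (F : κ → Fun G) :
    Q.act (∑ i ∈ s, F i) = ∑ i ∈ s, Q.act (F i) := by
  simp only [act, map_sum, Finset.mul_sum]
  exact Finset.sum_comm

lemma act_gen (Q : VectorField G) (ξ : Module.Dual k G) :
    Q.act (CSym.gen (G.shift 1).dual ξ) = Q ξ := by
  have h : ∀ y : G, dirDeriv y (CSym.gen (G.shift 1).dual ξ) = ξ y • (1 : Fun G) :=
    fun y => CSym.leftDeriv_gen _ _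
  simp only [act, h, mul_smul_comm, mul_one, ← map_smul, ← map_sum]
  congr 1
  exact (Module.finBasis k G).ext fun j => by simp

lemma act_gen_mul {Q : VectorField G} (hQ : Q.IsHomog 1) {a : ℤ} {ξ : Module.Dual k G}
    (hξ : ξ ∈ (G.shift 1).dual.gr a) (F : Fun G) :
    Q.act (CSym.gen (G.shift 1).dual ξ * F)
      = Q ξ * F + ksign k a • (CSym.gen (G.shift 1).dual ξ * Q.act F) := by
  obtain ⟨m, b, d, hb⟩ := G.exists_homogeneous_basis_shift 1
  have h1 : ∀ i, Q (b.coord i) * dirDeriv (b i) (CSym.gen (G.shift 1).dual ξ * F)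
      = (Q (b.coord i) * dirDeriv (b i) (CSym.gen (G.shift 1).dual ξ)) * F
        + ksign k a • (CSym.gen (G.shift 1).dual ξ * (Q (b.coord i) * dirDeriv (b i) F)) := by
    intro i
    have hg : dirDeriv (b i) (CSym.gen (G.shift 1).dual ξ) = ξ (b i) • (1 : Fun G) :=
      CSym.leftDeriv_gen _ _
    have hm : dirDeriv (b i) (CSym.gen (G.shift 1).dual ξ * F) = ξ (b i) • F
        + ksign k (d i * a) • (CSym.gen (G.shift 1).dual ξ * dirDeriv (b i) F) :=
      CSym.leftDeriv_gen_mul (eval_mem_gr (A := G.shift 1) (hb i)) hξ F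
    have hc := CSym.IsHomog.comm (hQ _ _ (coord_mem_gr (A := G.shift 1) b hb i))
      (CSym.IsHomog.gen hξ)
    rw [hg, hm, mul_add, mul_smul_comm, mul_smul_comm, mul_smul_comm, mul_one, smul_mul_assoc,
      ← mul_assoc, hc, smul_mul_assoc, smul_smul, ← ksign_add, mul_assoc]
    congr 2
    -- The exponents are `d i * a` from the Leibniz rule and `(-d i + 1) * a` from moving `Q
    -- (b.coord i)` past `ξ`; their sum is `a`, independently of `i`.
    refine ksign_congr ⟨0, by ring⟩
  rw [act_eq_sum_basis Q _ b, act_eq_sum_basis Q F b, ← act_gen Q ξ, act_eq_sum_basis Q _ b]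
  simp only [h1, Finset.sum_add_distrib, Finset.sum_mul, Finset.mul_sum, Finset.smul_sum]

end VectorField

/-! ### The Poisson bracket and the classical master equation. -/

namespace ShiftedSymplectic

variable {k : Type u} [Field k] {G : GrSpace.{u, v} k} {n : ℤ} (ω : ShiftedSymplectic G n)

lemma sgn_one_sgn_one (y : G) : G.sgn 1 (G.sgn 1 y) = y := by
  refine G.induction_gr (p := fun y => G.sgn 1 (G.sgn 1 y) = y) y ?_ (by simp) ?_
  · intro d b hb
    rw [sgn, diag_of_mem G _ hb, map_smul, diag_of_mem G _ hb, smul_smul, ksign_mul_self, one_smul]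
  · intro b c hb hc
    simp only [map_add, hb, hc]

lemma shifted_of_mem {d : ℤ} {y : G} (hy : y ∈ G.gr d) (z : G) :
    ω.shifted y z = ksign k d * ω.form y z := by
  rw [shifted, LinearMap.comp_apply, sgn, diag_of_mem G _ hy, map_smul, one_mul]
  rfl

/-- The form on `𝔤[1]` as a map of degree `n` to the dual. -/
def shiftedHom : GrHom (G.shift 1) ((G.shift 1).dual.shift n) where
  lin := ω.shifted
  map_gr d y hy e he a ha := by
    have hy' : y ∈ G.gr (d + 1) := hy
    rw [ω.shifted_of_mem hy', ω.degree _ _ _ hy' _ ha (by omega), mul_zero]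

lemma shifted_bijective : Function.Bijective ω.shifted := by
  have h : Function.Bijective (G.sgn 1) := Function.bijective_iff_has_inverse.2
    ⟨G.sgn 1, sgn_one_sgn_one, sgn_one_sgn_one⟩
  exact ω.form.bijective.comp h

/-- The sign in `shifted` and the sign in `hamiltonian` are the same involution and cancel. Later
arguments use the Hamiltonian field through this identity. -/
lemma hamiltonian_shifted (S : Fun G) (y : G) :
    ω.hamiltonian S (ω.shifted y) = dirDerivRight y S := by
  change dirDerivRight (G.sgn 1 (ω.form.symm (ω.form (G.sgn 1 y)))) S = _
  rw [LinearEquiv.symm_apply_apply, sgn_one_sgn_one]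

/-- Graded antisymmetry of the form on `𝔤[1]`. -/
lemma shifted_antisymm (y z : G) :
    ω.shifted y z = -ω.shifted ((G.shift 1).sgn (n + 1) z) y := by
  refine G.induction_gr (p := fun z => ω.shifted y z
    = -ω.shifted ((G.shift 1).sgn (n + 1) z) y) z ?_ (by simp) ?_
  · intro e z hz
    have hz' : z ∈ (G.shift 1).gr (e - 1) := by
      change z ∈ G.gr (e - 1 + 1); rwa [sub_add_cancel]
    rw [sgn, diag_of_mem (G.shift 1) _ hz', map_smul, LinearMap.smul_apply,
      ω.shifted_of_mem hz, smul_eq_mul]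
    refine G.induction_gr (p := fun y => ω.shifted y z
      = -(ksign k ((n + 1) * (e - 1)) * (ksign k e * ω.form z y))) y ?_ (by simp) ?_
    · intro d y hy
      rw [ω.shifted_of_mem hy, ω.symm d e y hy z hz]
      -- The form vanishes outside these degrees. Inside them both exponents, `d + d e` and `1 + (n
      -- + 1)(e - 1) + e`, have the parity of `n + n e`.
      by_cases h : d + e = 2 - n
      · rw [← mul_assoc, ← mul_assoc, ← neg_mul, ← ksign_add, ← ksign_add,
          ← neg_one_mul (ksign k _), ← ksign_of_odd (k := k) odd_one, ← ksign_add]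
        congr 1
        refine ksign_congr ?_
        obtain rfl : d = 2 - n - e := by omega
        simp only [Int.even_add, Int.even_sub, Int.even_mul, Int.not_even_one, even_two]
        tauto
      · rw [ω.degree e d z hz y hy (by omega)]; simp
    · intro a b ha hb
      simp only [map_add, LinearMap.add_apply, ha, hb]; ring
  · intro a b ha hb
    simp only [map_add, LinearMap.add_apply, ha, hb]; ring

/-- The resolution of the identity opposite to the one given by a homogeneous basis. -/
lemma sum_shifted_smul {κ : Type*} [Fintype κ] (b : Module.Basis κ k G) {d : κ → ℤ}
    (hb : ∀ i, b i ∈ (G.shift 1).gr (d i)) {z : κ → G} (hz : ∀ i, ω.shifted (z i) = b.coord i)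
    (y : G) : ∑ i, ((-ksign k ((n + 1) * d i)) • ω.shifted (b i)) y • z i = y := by
  -- By nondegeneracy the two vectors may be compared after applying `Ω`. Pairing with `v` and using
  -- antisymmetry reduces the claim to the expansion of `v` in the basis `b`.
  apply ω.shifted_bijective.1
  refine LinearMap.ext fun v => ?_
  have hv : (G.shift 1).sgn (n + 1) v
      = ∑ i, b.coord i v • ksign k ((n + 1) * d i) • b i := by
    conv_lhs => rw [← b.sum_repr v]
    simp only [map_sum, map_smul, Module.Basis.coord_apply]
    refine Finset.sum_congr rfl fun i _ => ?_
    rw [sgn, diag_of_mem (G.shift 1) _ (hb i)]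
  rw [ω.shifted_antisymm y v, hv]
  simp only [map_sum, map_smul, LinearMap.sum_apply, LinearMap.smul_apply, hz,
    smul_eq_mul, neg_mul, Finset.sum_neg_distrib]
  congr 1
  exact Finset.sum_congr rfl fun i _ => by ring

lemma exists_homogeneous_shifted_eq {d : ℤ} {ξ : Module.Dual k G}
    (hξ : ξ ∈ (G.shift 1).dual.gr d) : ∃ z ∈ (G.shift 1).gr (d - n), ω.shifted z = ξ := by
  refine ⟨(ω.shiftedHom.inverse ω.shifted_bijective).lin ξ, GrHom.map_gr _ _ _ ?_,
    (LinearEquiv.ofBijective ω.shifted ω.shifted_bijective).apply_symm_apply ξ⟩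
  change _ ∈ (G.shift 1).dual.gr (d - n + n)
  rwa [sub_add_cancel]

/-- One bracket is computed in a homogeneous basis `b`, the other in the opposite resolution formed
by the vectors `z i` that `Ω` sends to the coordinates of `b`. The two sums then agree summand by
summand. -/
lemma bracket_comm {S T : Fun G} (hS : CSym.IsHomog (n + 1) S) (hT : CSym.IsHomog (n + 1) T) :
    ω.bracket S T = ω.bracket T S := by
  obtain ⟨m, b, d, hb⟩ := G.exists_homogeneous_basis_shift 1
  choose z hzd hz using fun i =>
    ω.exists_homogeneous_shifted_eq (coord_mem_gr (A := G.shift 1) b hb i)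
  rw [bracket, bracket, VectorField.act_eq_sum_basis _ T b,
    VectorField.act_eq_sum _ S _ z (ω.sum_shifted_smul b hb hz)]
  refine Finset.sum_congr rfl fun i _ => ?_
  rw [← hz i, map_smul, hamiltonian_shifted, hamiltonian_shifted, smul_mul_assoc]
  exact CSym.IsHomog.rightDeriv_mul_leftDeriv (eval_mem_gr (A := G.shift 1) (hb i))
    (eval_mem_gr (A := G.shift 1) (hzd i)) hS hT

/-- The classical master equation for the action functional of an `L_∞` structure. -/
lemma bracket_self_eq_zero [CharZero k] {S : Fun G} (hS : CSym.IsHomog (n + 1) S)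
    (hS₁ : CSym.coeff 1 S = 0) (hQ : (ω.hamiltonian S).IsLInfinity) : ω.bracket S S = 0 := by
  -- `S ∂_y` is the value of the vector field on a linear coordinate, so this is `Q² = 0` on that
  -- coordinate.
  have hR : ∀ y, (ω.hamiltonian S).act (dirDerivRight y S) = 0 := fun y => by
    rw [← hamiltonian_shifted, ← VectorField.act_gen]
    exact hQ.square _
  obtain ⟨m, b, d, hb⟩ := G.exists_homogeneous_basis_shift 1
  have hL : ∀ i, (ω.hamiltonian S).act (dirDeriv (b i) S) = 0 := fun i => by
    have h : dirDeriv (b i) S = ksign k (d i * (n + 1 + 1)) • dirDerivRight (b i) S :=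
      CSym.IsHomog.leftDeriv_eq (eval_mem_gr (A := G.shift 1) (hb i)) hS
    rw [h, VectorField.act_smul, hR, smul_zero]
  -- In `Q (∑ x^i ∂_i S)` the terms `x^i Q(∂_i S)` vanish by `hL`, which leaves `∑ Q(x^i) ∂_i S`.
  have hE : ω.bracket S (CSym.euler S) = ω.bracket S S := by
    have h : CSym.euler S = ∑ i, CSym.gen (G.shift 1).dual (b.coord i) * dirDeriv (b i) S :=
      CSym.euler_eq_sum (G.shift 1) b hb S
    rw [h, bracket, VectorField.act_sum, bracket, VectorField.act_eq_sum_basis _ S b]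
    refine Finset.sum_congr rfl fun i _ => ?_
    rw [VectorField.act_gen_mul hQ.degree (coord_mem_gr (A := G.shift 1) b hb i), hL,
      mul_zero, smul_zero, add_zero]
  -- The two summands `{S, S}` on the left compensate for the two derivatives in the bracket, each
  -- of which lowers the polynomial degree by one.
  have hE2 : CSym.euler (ω.bracket S S) + (ω.bracket S S + ω.bracket S S)
      = ω.bracket (CSym.euler S) S + ω.bracket S (CSym.euler S) := by
    simp only [bracket, VectorField.act, CSym.euler_sum, ← Finset.sum_add_distrib]
    refine Finset.sum_congr rfl fun i _ => ?_
    have h1 : ∀ ξ, ω.hamiltonian (CSym.euler S) ξ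
        = CSym.euler (ω.hamiltonian S ξ) + ω.hamiltonian S ξ :=
      fun ξ => CSym.rightDeriv_euler _ S
    have h2 : ∀ y, dirDeriv y (CSym.euler S) = CSym.euler (dirDeriv y S) + dirDeriv y S :=
      fun y => CSym.leftDeriv_euler _ S
    rw [h1, h2, CSym.euler_mul, add_mul, mul_add]
    abel
  rw [← ω.bracket_comm hS hS.euler, hE] at hE2
  -- By symmetry and `hE` the right side of `hE2` is `2 {S, S}`, so only the Euler term remains. The
  -- constant term is treated next: derivatives of `S` have none, as `S` has no linear part.
  refine CSym.eq_zero_of_euler_eq_zero (by simpa using hE2) ?_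
  rw [bracket, VectorField.act, CSym.coeff_sum]
  refine Finset.sum_eq_zero fun i _ => ?_
  have h0 : ∀ y, CSym.coeff 0 (dirDeriv y S) = 0 := fun y => by
    rw [dirDeriv, CSym.coeff_leftDeriv, hS₁, map_zero]
  simp [CSym.coeff_mul, h0]

end ShiftedSymplectic

/-- The projection of a direct sum to its first summand. -/
@[reducible] def GrHom.fst {k : Type u} [Field k] (A : GrSpace.{u, v} k) (B : GrSpace.{u, w} k) :
    GrHom (A.prod B) A where
  lin := LinearMap.fst k A B
  map_gr _ _ ha := ha.1

/-! ### The weight grading of `Sym(A ⊕ B)` by the number of letters from `B`. -/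

namespace GSym

variable {k : Type u} [Field k] {A : GrSpace.{u, v} k} {B : GrSpace.{u, w} k}

lemma weightHom_ι (y : A.prod B) : weightHom A B (ι (A.prod B) y)
    = Polynomial.C (ι (A.prod B) (y.1, 0)) + Polynomial.X * Polynomial.C (ι (A.prod B) (0, y.2)) :=
  lift_ι _ _ y

lemma weightPart_apply (j : ℕ) (a : GSym (A.prod B)) :
    weightPart A B j a = (weightHom A B a).coeff j := rfl

lemma weightPart_algebraMap (j : ℕ) (r : k) : weightPart A B j (algebraMap k _ r)
    = if j = 0 then algebraMap k _ r else 0 := by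
  rw [weightPart_apply, AlgHom.commutes, Polynomial.algebraMap_apply, Polynomial.coeff_C]

lemma weightPart_zero_ι_mul (y : A.prod B) (b : GSym (A.prod B)) :
    weightPart A B 0 (ι (A.prod B) y * b) = ι (A.prod B) (y.1, 0) * weightPart A B 0 b := by
  simp only [weightPart_apply, map_mul, weightHom_ι y, add_mul, mul_assoc, Polynomial.coeff_add,
    Polynomial.coeff_C_mul, Polynomial.coeff_X_mul_zero, add_zero]

lemma weightPart_succ_ι_mul (j : ℕ) (y : A.prod B) (b : GSym (A.prod B)) :
    weightPart A B (j + 1) (ι (A.prod B) y * b) = ι (A.prod B) (y.1, 0) * weightPart A B (j + 1) b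
      + ι (A.prod B) (0, y.2) * weightPart A B j b := by
  simp only [weightPart_apply, map_mul, weightHom_ι y, add_mul, mul_assoc, Polynomial.coeff_add,
    Polynomial.coeff_C_mul, Polynomial.coeff_X_mul]

lemma weightPart_zero_mul_ι (b : GSym (A.prod B)) (y : A.prod B) :
    weightPart A B 0 (b * ι (A.prod B) y) = weightPart A B 0 b * ι (A.prod B) (y.1, 0) := by
  simp only [weightPart_apply, map_mul, weightHom_ι y, mul_add, Polynomial.coeff_add,
    Polynomial.coeff_mul_C, ← mul_assoc, Polynomial.coeff_mul_X_zero, zero_mul, add_zero]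

lemma weightPart_succ_mul_ι (j : ℕ) (b : GSym (A.prod B)) (y : A.prod B) :
    weightPart A B (j + 1) (b * ι (A.prod B) y) = weightPart A B (j + 1) b * ι (A.prod B) (y.1, 0)
      + weightPart A B j b * ι (A.prod B) (0, y.2) := by
  simp only [weightPart_apply, map_mul, weightHom_ι y, mul_add, Polynomial.coeff_add,
    Polynomial.coeff_mul_C, ← mul_assoc, Polynomial.coeff_mul_X]

lemma weightPart_mem_homog (j : ℕ) {d : ℤ} {a : GSym (A.prod B)} (ha : a ∈ homog (A.prod B) d) :
    weightPart A B j a ∈ homog (A.prod B) d := by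
  refine homog_induction (A := A.prod B)
    (P := fun d a => ∀ j, weightPart A B j a ∈ homog (A.prod B) d) ?_ ?_ ?_ ?_ ?_ ha j
  · intro j
    rw [← map_one (algebraMap k _), weightPart_algebraMap]
    split_ifs
    · exact algebraMap_mem_homog 1
    · exact zero_mem _
  · intro e m y hy b _ ih j
    have h1 : (y.1, (0 : B)) ∈ (A.prod B).gr e := ⟨hy.1, zero_mem _⟩
    have h2 : ((0 : A), y.2) ∈ (A.prod B).gr e := ⟨zero_mem _, hy.2⟩
    rcases j with _ | j
    · rw [weightPart_zero_ι_mul]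
      exact ι_mul_mem_homog h1 (ih 0)
    · rw [weightPart_succ_ι_mul]
      exact add_mem (ι_mul_mem_homog h1 (ih _)) (ι_mul_mem_homog h2 (ih _))
  · intro m j
    rw [map_zero]; exact zero_mem _
  · intro m a b ha hb j
    rw [map_add]; exact add_mem (ha j) (hb j)
  · intro m c a ha j
    rw [map_smul]; exact Submodule.smul_mem _ _ (ha j)

/-- A word of length `p` has at most `p` letters from `B`. -/
lemma weightPart_eq_zero {p j : ℕ} (hj : p < j) {a : GSym (A.prod B)}
    (ha : a ∈ pow (A.prod B) p) : weightPart A B j a = 0 := by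
  unfold pow at ha
  induction ha using Submodule.pow_induction_on_left' generalizing j with
  | algebraMap r => rw [weightPart_algebraMap, if_neg (by omega)]
  | add b c p hb hc ihb ihc => rw [map_add, ihb hj, ihc hj, add_zero]
  | mem_mul m hm p b hb ih =>
    obtain ⟨y, rfl⟩ := hm
    obtain ⟨j, rfl⟩ : ∃ i, j = i + 1 := ⟨j - 1, by omega⟩
    rw [weightPart_succ_ι_mul, ih (by omega), ih (by omega), mul_zero, mul_zero, add_zero]

lemma ι_split (y : A.prod B) :
    ι (A.prod B) y = ι (A.prod B) (y.1, 0) + ι (A.prod B) (0, y.2) := by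
  rw [← map_add]; simp

/-- This is `weightHom` evaluated at `t = 1`; no weight above `p` occurs in a word of length `p`. -/
lemma sum_weightPart {p : ℕ} {a : GSym (A.prod B)} (ha : a ∈ pow (A.prod B) p) :
    ∑ j ∈ Finset.range (p + 1), weightPart A B j a = a := by
  unfold pow at ha
  induction ha using Submodule.pow_induction_on_left' with
  | algebraMap r => simp [weightPart_algebraMap]
  | add b c p hb hc ihb ihc => simp only [map_add, Finset.sum_add_distrib, ihb, ihc]
  | mem_mul m hm p b hb ih =>
    obtain ⟨y, rfl⟩ := hm
    rw [Finset.sum_range_succ', weightPart_zero_ι_mul]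
    have h := fun j => weightPart_succ_ι_mul (A := A) (B := B) j y b
    simp only [h, Finset.sum_add_distrib, ← Finset.mul_sum]
    rw [ih, add_right_comm, ← mul_add,
      ← Finset.sum_range_succ' (fun j => weightPart A B j b) (p + 1), Finset.sum_range_succ, ih,
      weightPart_eq_zero (Nat.lt_succ_self p) hb, add_zero, ← add_mul, ← ι_split]

lemma range_inr_mul_range_inl_le :
    LinearMap.range (ι (A.prod B) ∘ₗ LinearMap.inr k A B) *
        LinearMap.range (ι (A.prod B) ∘ₗ LinearMap.inl k A B) ≤
      LinearMap.range (ι (A.prod B) ∘ₗ LinearMap.inl k A B) *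
        LinearMap.range (ι (A.prod B) ∘ₗ LinearMap.inr k A B) := by
  rw [Submodule.mul_le]
  rintro _ ⟨b, rfl⟩ _ ⟨a, rfl⟩
  set N := LinearMap.range (ι (A.prod B) ∘ₗ LinearMap.inl k A B) *
        LinearMap.range (ι (A.prod B) ∘ₗ LinearMap.inr k A B)
  refine B.induction_gr (p := fun b => (ι (A.prod B) ∘ₗ LinearMap.inr k A B) b *
    (ι (A.prod B) ∘ₗ LinearMap.inl k A B) a ∈ N) b ?_
    (by rw [map_zero, zero_mul]; exact zero_mem _) ?_
  · intro d b hb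
    refine A.induction_gr (p := fun a => (ι (A.prod B) ∘ₗ LinearMap.inr k A B) b *
      (ι (A.prod B) ∘ₗ LinearMap.inl k A B) a ∈ N) a ?_
      (by rw [map_zero, mul_zero]; exact zero_mem _) ?_
    · intro e a ha
      have h1 : ((0 : A), b) ∈ (A.prod B).gr d := ⟨zero_mem _, hb⟩
      have h2 : (a, (0 : B)) ∈ (A.prod B).gr e := ⟨ha, zero_mem _⟩
      have h3 := ι_comm (A.prod B) h1 h2
      change ι (A.prod B) (0, b) * ι (A.prod B) (a, 0) ∈ N
      rw [h3]
      exact Submodule.smul_mem _ _ (Submodule.mul_mem_mul ⟨a, rfl⟩ ⟨b, rfl⟩)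
    · intro a a' h h'
      rw [map_add, mul_add]; exact add_mem h h'
  · intro b b' h h'
    rw [map_add, add_mul]; exact add_mem h h'

lemma mul_pow_le_of_mul_le {R : Type*} [Semiring R] [Algebra k R] {U W : Submodule k R}
    (h : W * U ≤ U * W) (i : ℕ) : W * U ^ i ≤ U ^ i * W := by
  induction i with
  | zero => simp
  | succ i ih =>
    calc W * U ^ (i + 1) = W * U ^ i * U := by rw [pow_succ, mul_assoc]
      _ ≤ U ^ i * W * U := mul_le_mul_left ih _
      _ = U ^ i * (W * U) := mul_assoc _ _ _
      _ ≤ U ^ i * (U * W) := mul_le_mul_right h _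
      _ = U ^ (i + 1) * W := by rw [pow_succ, mul_assoc]

/-- Words are put in normal order, letters from `A` before letters from `B`. The only input about
these letters is `W * U ≤ U * W`, which comes from graded commutativity. -/
lemma weightPart_mem {p j : ℕ} (hj : j ≤ p) {a : GSym (A.prod B)} (ha : a ∈ pow (A.prod B) p) :
    weightPart A B j a ∈ LinearMap.range (ι (A.prod B) ∘ₗ LinearMap.inl k A B) ^ (p - j) *
      LinearMap.range (ι (A.prod B) ∘ₗ LinearMap.inr k A B) ^ j := by
  have hUW := range_inr_mul_range_inl_le (A := A) (B := B)
  have hU : ∀ y : A.prod B, ι (A.prod B) (y.1, 0) ∈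
      LinearMap.range (ι (A.prod B) ∘ₗ LinearMap.inl k A B) := fun y => ⟨y.1, rfl⟩
  have hW : ∀ y : A.prod B, ι (A.prod B) (0, y.2) ∈
      LinearMap.range (ι (A.prod B) ∘ₗ LinearMap.inr k A B) := fun y => ⟨y.2, rfl⟩
  generalize LinearMap.range (ι (A.prod B) ∘ₗ LinearMap.inl k A B) = U at *
  generalize LinearMap.range (ι (A.prod B) ∘ₗ LinearMap.inr k A B) = W at *
  unfold pow at ha
  induction ha using Submodule.pow_induction_on_left' generalizing j with
  | algebraMap r =>
    obtain rfl : j = 0 := by omega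
    rw [weightPart_algebraMap, if_pos rfl]
    simp
  | add b c p hb hc ihb ihc => rw [map_add]; exact add_mem (ihb hj) (ihc hj)
  | mem_mul m hm p b hb ih =>
    obtain ⟨y, rfl⟩ := hm
    rcases j with _ | j
    · have h := ih (Nat.zero_le p)
      rw [Nat.sub_zero] at h
      rw [weightPart_zero_ι_mul, Nat.sub_zero, pow_succ', mul_assoc]
      exact Submodule.mul_mem_mul (hU y) h
    · rw [weightPart_succ_ι_mul, Nat.succ_sub_succ]
      refine add_mem ?_ ?_
      · rcases Nat.lt_or_ge p (j + 1) with h | h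
        · rw [weightPart_eq_zero h hb, mul_zero]; exact zero_mem _
        · rw [show p - j = p - (j + 1) + 1 by omega, pow_succ', mul_assoc]
          exact Submodule.mul_mem_mul (hU y) (ih h)
      · have h3 : W * (U ^ (p - j) * W ^ j) ≤ U ^ (p - j) * W ^ (j + 1) := by
          rw [← mul_assoc, pow_succ', ← mul_assoc]
          exact mul_le_mul_left (mul_pow_le_of_mul_le hUW _) _
        exact h3 (Submodule.mul_mem_mul (hW y) (ih (by omega)))

/-- Setting `t = 0` kills the letters from `B`: this is restriction to the zero section followed by
pullback. -/
lemma weightPart_zero (a : GSym (A.prod B)) :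
    weightPart A B 0 a = map (GrHom.inl A B) (map (GrHom.fst A B) a) := by
  induction a using GSym.induction with
  | hc r => rw [weightPart_algebraMap, if_pos rfl, AlgHom.commutes, AlgHom.commutes]
  | hι y =>
    have := weightPart_zero_ι_mul (A := A) (B := B) y 1
    rw [← map_one (algebraMap k (GSym (A.prod B))), weightPart_algebraMap, if_pos rfl, map_one,
      mul_one, mul_one] at this
    rw [this, map_ι, map_ι]
    rfl
  | hm b c hb hc =>
    rw [weightPart_apply, map_mul, Polynomial.mul_coeff_zero, ← weightPart_apply,
      ← weightPart_apply, hb, hc, map_mul, map_mul]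
  | ha b c hb hc => simp only [map_add, hb, hc]

/-- The part of weight one is recovered from the derivatives along the fibres. -/
lemma weightPart_one {κ : Type*} [Fintype κ] (c : κ → B) (e : κ → ℤ) (hc : ∀ i, c i ∈ B.gr (e i))
    (φ : κ → Module.Dual k B) (hφ : ∀ i, φ i ∈ B.dual.gr (-e i))
    (hres : ∀ y, ∑ i, φ i y • c i = y) (a : GSym (A.prod B)) {p : ℕ}
    (ha : a ∈ pow (A.prod B) p) :
    weightPart A B 1 a = ∑ i, weightPart A B 0
      (rightDeriv (A.prod B) (φ i ∘ₗ LinearMap.snd k A B) a) * ι (A.prod B) (0, c i) := by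
  have hψ : ∀ i, φ i ∘ₗ LinearMap.snd k A B ∈ (A.prod B).dual.gr (-e i) :=
    fun i d hd y hy => hφ i d hd y.2 hy.2
  unfold pow at ha
  -- Letters are added on the right, where the right derivative acts first and where the factor `c
  -- i` is placed.
  induction ha using Submodule.pow_induction_on_right' with
  | algebraMap r => simp [weightPart_algebraMap, rightDeriv_algebraMap]
  | add b b' p hb hb' ihb ihb' =>
    simp only [map_add, add_mul, Finset.sum_add_distrib, ihb, ihb']
  | mul_mem p b hb ih m hm =>
    obtain ⟨y, rfl⟩ := hm
    refine (A.prod B).induction_gr (p := fun y => weightPart A B 1 (b * ι (A.prod B) y)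
      = ∑ i, weightPart A B 0 (rightDeriv (A.prod B) (φ i ∘ₗ LinearMap.snd k A B)
        (b * ι (A.prod B) y)) * ι (A.prod B) (0, c i)) y ?_ (by simp) ?_
    · intro d y hy
      -- Either `φ i` hits the last letter `y`, or `y` contributes only its component in `A`. In the
      -- second case the sign from commuting it past `c i` cancels the Leibniz sign.
      have h1 : ∀ i, weightPart A B 0 (rightDeriv (A.prod B) (φ i ∘ₗ LinearMap.snd k A B)
          (b * ι (A.prod B) y)) * ι (A.prod B) (0, c i)
          = weightPart A B 0 b * ι (A.prod B) (0, φ i y.2 • c i)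
            + weightPart A B 0 (rightDeriv (A.prod B) (φ i ∘ₗ LinearMap.snd k A B) b) *
              ι (A.prod B) (0, c i) * ι (A.prod B) (y.1, 0) := by
        intro i
        have hy1 : (y.1, (0 : B)) ∈ (A.prod B).gr d := ⟨hy.1, zero_mem _⟩
        have hci : ((0 : A), c i) ∈ (A.prod B).gr (e i) := ⟨zero_mem _, hc i⟩
        have hs : ((0 : A), φ i y.2 • c i) = φ i y.2 • ((0 : A), c i) := by simp
        rw [rightDeriv_mul (hψ i) b (ι_mem_homog hy), rightDeriv_ι, ← Algebra.commutes,
          ← Algebra.smul_def, map_add, map_smul, map_smul, weightPart_zero_mul_ι, add_mul,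
          smul_mul_assoc, smul_mul_assoc, hs, map_smul, mul_smul_comm, mul_assoc _ (ι _ _) (ι _ _),
          ι_comm (A.prod B) hy1 hci, mul_smul_comm, smul_smul, ← ksign_add, ksign_of_even,
          one_smul, ← mul_assoc]
        · rfl
        · exact ⟨0, by ring⟩
      have h2 : ∑ i, ((0 : A), φ i y.2 • c i) = (0, y.2) := by
        refine Prod.ext (by simp [Prod.fst_sum]) ?_
        rw [Prod.snd_sum]
        exact hres y.2
      simp only [h1, Finset.sum_add_distrib]
      rw [weightPart_succ_mul_ι, ih, ← Finset.sum_mul, ← Finset.mul_sum, ← map_sum, h2, add_comm]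
    · intro y z hy hz
      simp only [map_add, mul_add, add_mul, Finset.sum_add_distrib, hy, hz]

end GSym

/-! ### Decomposition of a polyvector field by polyvector degree. -/

namespace PolyVec

variable {k : Type u} [Field k] {n : ℤ} {L : GrSpace.{u, v} k}

lemma coeff_component (j p : ℕ) (P : PolyVec n L) : CSym.coeff p (component j P)
    = GSym.weightPart (L.shift 1).dual (L.shift (1 - n)) j (CSym.coeff p P) :=
  CSym.coeff_extend _ _ _ _ _

lemma isPolyDegree_component (j : ℕ) (P : PolyVec n L) : IsPolyDegree j (component j P) := by
  intro p
  rw [coeff_component]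
  rcases Nat.lt_or_ge p j with h | h
  · rw [GSym.weightPart_eq_zero h (CSym.coeff_mem_pow p P)]
    exact zero_mem _
  · exact Submodule.mem_iSup_of_mem (p - j) (Submodule.mem_iSup_of_mem (Nat.sub_add_cancel h)
      (GSym.weightPart_mem h (CSym.coeff_mem_pow p P)))

lemma isHomog_component {d : ℤ} {P : PolyVec n L} (hP : CSym.IsHomog d P) (j : ℕ) :
    CSym.IsHomog d (component j P) := fun p => by
  rw [coeff_component]
  exact GSym.weightPart_mem_homog j (hP p)

/-- The restriction of a polyvector field to the zero section. -/
def restrict (n : ℤ) (L : GrSpace.{u, v} k) : PolyVec n L →ₗ[k] Fun L :=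
  CSym.map (GrHom.fst (L.shift 1).dual (L.shift (1 - n)))

lemma component_zero (P : PolyVec n L) : component 0 P = ofFun n L (restrict n L P) := by
  refine CSym.ext_coeff fun p => ?_
  rw [coeff_component, ofFun, restrict, CSym.coeff_map, CSym.coeff_map]
  exact GSym.weightPart_zero _

lemma ofFun_restrict_coeff (p : ℕ) (P : PolyVec n L) :
    CSym.coeff p (ofFun n L (restrict n L P))
      = GSym.weightPart (L.shift 1).dual (L.shift (1 - n)) 0 (CSym.coeff p P) := by
  rw [← component_zero, coeff_component]

lemma fibreDual_add (η η' : Module.Dual k L) :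
    fibreDual n (η + η') = fibreDual n η + fibreDual n η' := rfl

lemma fibreDual_smul (c : k) (η : Module.Dual k L) :
    fibreDual n (c • η) = c • fibreDual n η := rfl

lemma θ_add (y z : L) : θ n L (y + z) = θ n L y + θ n L z := by
  rw [θ, θ, θ, ← CSym.gen_add, Prod.mk_add_mk, add_zero]

lemma θ_smul (c : k) (y : L) : θ n L (c • y) = c • θ n L y := by
  rw [θ, θ, ← CSym.gen_smul, Prod.smul_mk, smul_zero]

/-- The summands of the part of polyvector degree one, as a bilinear map. -/
def linearTerm (P : PolyVec n L) : Module.Dual k L →ₗ[k] L →ₗ[k] PolyVec n L :=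
  LinearMap.mk₂ k
    (fun η y => ofFun n L (restrict n L (CSym.rightDeriv (fibreDual n η) P)) * θ n L y)
    (fun η η' y => by
      rw [fibreDual_add, CSym.rightDeriv_add, map_add, map_add, add_mul])
    (fun c η y => by
      rw [fibreDual_smul, CSym.rightDeriv_smul, map_smul, map_smul, smul_mul_assoc])
    (fun η y z => by rw [θ_add, mul_add])
    (fun c η y => by rw [θ_smul, mul_smul_comm])

lemma coeff_zero_linearTerm (P : PolyVec n L) (η : Module.Dual k L) (y : L) :
    CSym.coeff 0 (linearTerm P η y) = 0 := CSym.coeff_zero_mul_gen _ _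

lemma coeff_succ_linearTerm (P : PolyVec n L) (η : Module.Dual k L) (y : L) (p : ℕ) :
    CSym.coeff (p + 1) (linearTerm P η y)
      = GSym.weightPart (L.shift 1).dual (L.shift (1 - n)) 0
          (GSym.rightDeriv _ (fibreDual n η) (CSym.coeff (p + 1) P)) *
        GSym.ι ((L.shift 1).dual.prod (L.shift (1 - n))) (0, y) := by
  rw [linearTerm, LinearMap.mk₂_apply, θ, CSym.coeff_succ_mul_gen, ofFun_restrict_coeff,
    CSym.coeff_rightDeriv]

/-- `weightPart_one` needs a homogeneous basis because of the Koszul signs. Bilinearity of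
`linearTerm` transports the result to the arbitrary basis used in `ofVectorField`. -/
lemma component_one (P : PolyVec n L) :
    component 1 P
      = ∑ i, linearTerm P ((Module.finBasis k L).coord i) (Module.finBasis k L i) := by
  obtain ⟨m, b, d, hb⟩ := L.exists_homogeneous_basis_shift (1 - n)
  refine Eq.trans ?_ (sum_basis_eq_sum_basis (Module.finBasis k L) b (linearTerm P)).symm
  refine CSym.ext_coeff fun p => ?_
  rw [coeff_component, CSym.coeff_sum]
  rcases p with _ | p
  · rw [GSym.weightPart_eq_zero Nat.zero_lt_one (CSym.coeff_mem_pow 0 P)]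
    exact (Finset.sum_eq_zero fun i _ => coeff_zero_linearTerm _ _ _).symm
  · rw [GSym.weightPart_one (B := L.shift (1 - n)) b d hb (fun i => b.coord i)
      (fun i => coord_mem_gr (A := L.shift (1 - n)) b hb i) (fun y => by simp) _
      (CSym.coeff_mem_pow (p + 1) P)]
    exact Finset.sum_congr rfl fun i _ => (coeff_succ_linearTerm P (b.coord i) (b i) p).symm

lemma eq_components_add_tower (P : PolyVec n L) :
    P = component 0 P + component 1 P + tower (fun j => component j P) := by
  refine CSym.ext_coeff fun p => ?_
  rw [CSym.coeff_add, CSym.coeff_add, tower, CSym.coeff_ofCoeff]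
  simp only [coeff_component]
  have hp := CSym.coeff_mem_pow p P
  conv_lhs => rw [← GSym.sum_weightPart hp]
  -- For `p = 0` the range of weights is only `{0}`, so the weight one term on the right must be
  -- shown to vanish. For larger `p` the weights `0` and `1` are split off.
  rcases p with _ | p
  · rw [GSym.weightPart_eq_zero Nat.zero_lt_one hp]
    simp
  · rw [Finset.range_eq_Ico, Finset.sum_eq_sum_Ico_succ_bot (by omega),
      Finset.sum_eq_sum_Ico_succ_bot (by omega), ← add_assoc]
    rfl

end PolyVec

/-! ### Strict maps on linear coordinates. -/

namespace IsStrictMap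

variable {k : Type u} [Field k] {G : GrSpace.{u, v} k} {L : GrSpace.{u, w} k}

/-- Strictness tested on a linear coordinate, whose pullback is again a linear coordinate. This is
the form in which strictness determines `S_0` and `S_1`. -/
lemma pullback_apply {f : GrHom L G} {Q' : VectorField L} {Q : VectorField G}
    (h : IsStrictMap f Q' Q) (ξ : Module.Dual k G) :
    pullback f (Q ξ) = Q' (ξ ∘ₗ f.lin) := by
  have := h (CSym.gen (G.shift 1).dual ξ)
  rw [VectorField.act_gen] at this
  rw [this, pullback, CSym.map_gen]
  exact VectorField.act_gen Q' (ξ ∘ₗ f.lin)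

end IsStrictMap

/-! ### Darboux coordinates adapted to the Lagrangian. -/

namespace LagrangianSplitting

variable {k : Type u} [Field k] {G : GrSpace.{u, v} k} {n : ℤ} {ω : ShiftedSymplectic G n}
  {Lp : GrSpace.{u, w} k} {Lm : GrSpace.{u, x} k} (D : LagrangianSplitting ω Lp Lm)

/-- The inverse of the change of coordinates. -/
def coordInv : GrHom (G.shift 1).dual ((Lp.shift 1).dual.prod (Lp.shift (1 - n))) :=
  D.coordHom.inverse D.coordHom_bijective

lemma toPolyVec_apply (F : Fun G) : D.toPolyVec F = CSym.map D.coordInv F := rfl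

lemma coordHom_coordInv (φ : Module.Dual k G) : D.coordHom.lin (D.coordInv.lin φ) = φ :=
  (LinearEquiv.ofBijective D.coordHom.lin D.coordHom_bijective).apply_symm_apply φ

/-- By functoriality the pushforward along `coordHom` is a left inverse. -/
lemma toPolyVec_injective : Function.Injective D.toPolyVec := by
  intro F F' h
  have hid : ∀ F : Fun G, CSym.map D.coordHom (D.toPolyVec F) = F := fun F => by
    let i : GrHom (G.shift 1).dual (G.shift 1).dual := ⟨LinearMap.id, fun _ _ h => h⟩
    rw [toPolyVec_apply, CSym.map_map_of_eq _ _ i fun φ => D.coordHom_coordInv φ]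
    exact CSym.map_eq_self i (fun _ => rfl) F
  rw [← hid F, h, hid]

lemma split_f (a : Lp) : D.split.lin (D.f.lin a) = (a, 0) := by simpa using D.split_sumHom a 0

lemma split_g (b : Lm) : D.split.lin (D.g.lin b) = (0, b) := by simpa using D.split_sumHom 0 b

lemma f_add_g_split (y : G) : D.f.lin (D.split.lin y).1 + D.g.lin (D.split.lin y).2 = y :=
  (LinearEquiv.ofBijective D.sumHom.lin D.sumHom_bijective).apply_symm_apply y

lemma shifted_f_f (a b : Lp) : ω.shifted (D.f.lin a) (D.f.lin b) = 0 :=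
  shifted_isotropic ω D.f D.f_isotropic a b

lemma shifted_g_g (a b : Lm) : ω.shifted (D.g.lin a) (D.g.lin b) = 0 :=
  shifted_isotropic ω D.g D.g_isotropic a b

lemma coordInv_coordHom (z : (Lp.shift 1).dual.prod (Lp.shift (1 - n))) :
    D.coordInv.lin (D.coordHom.lin z) = z :=
  (LinearEquiv.ofBijective D.coordHom.lin D.coordHom_bijective).symm_apply_apply z

/-- With `fibreDual_comp_coordInv`, this matches directions: base directions on `L₊` are vectors of
`𝔩₊`, and fibre directions are vectors of `𝔩₋` through `pairing`. -/
lemma baseDual_comp_coordInv (a : Lp) :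
    PolyVec.baseDual n a ∘ₗ D.coordInv.lin = Module.Dual.eval k G (D.f.lin a) := by
  refine LinearMap.ext fun φ => ?_
  obtain ⟨⟨ξ, b⟩, rfl⟩ := D.coordHom_bijective.2 φ
  rw [LinearMap.comp_apply, coordInv_coordHom, Module.Dual.eval_apply, coordHom_apply, split_f]
  simp [PolyVec.baseDual]

/-- The pairing of `𝔩₋` with `𝔩₊` given by the symplectic form. -/
def pairing : Lm →ₗ[k] Module.Dual k Lp := D.f.lin.dualMap ∘ₗ ω.shifted ∘ₗ D.g.lin

lemma pairing_apply (b : Lm) (a : Lp) :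
    D.pairing b a = ω.shifted (D.g.lin b) (D.f.lin a) := rfl

lemma fibreDual_comp_coordInv (b : Lm) :
    PolyVec.fibreDual n (D.pairing b) ∘ₗ D.coordInv.lin = Module.Dual.eval k G (D.g.lin b) := by
  refine LinearMap.ext fun φ => ?_
  obtain ⟨⟨ξ, a⟩, rfl⟩ := D.coordHom_bijective.2 φ
  rw [LinearMap.comp_apply, coordInv_coordHom, Module.Dual.eval_apply, coordHom_apply, split_g]
  simp [PolyVec.fibreDual, pairing_apply]

lemma shifted_g (b : Lm) (y : G) : ω.shifted (D.g.lin b) y = D.pairing b (D.split.lin y).1 := by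
  conv_lhs => rw [← D.f_add_g_split y]
  rw [map_add, shifted_g_g, add_zero, pairing_apply]

/-- Since `𝔩₋` is isotropic, `Ω(g b, ·)` depends only on the `𝔩₊`-component of its argument;
nondegeneracy then applies. -/
lemma pairing_injective : Function.Injective D.pairing := by
  rw [← LinearMap.ker_eq_bot, LinearMap.ker_eq_bot']
  intro b hb
  refine D.g_injective (ω.shifted_bijective.1 ?_)
  rw [map_zero, map_zero]
  exact LinearMap.ext fun y => by rw [shifted_g, hb]; rfl

/-- Extend `η` by zero on `𝔩₋` and represent the extension as `Ω(z, ·)`. The `𝔩₊`-component of `z`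
pairs to zero with `𝔩₊` by isotropy and with `𝔩₋` because the extension vanishes there, so `z` lies
in `𝔩₋`. -/
lemma pairing_surjective : Function.Surjective D.pairing := by
  intro η
  obtain ⟨z, hz⟩ := ω.shifted_bijective.2 (η ∘ₗ LinearMap.fst k Lp Lm ∘ₗ D.split.lin)
  have hf : D.f.lin (D.split.lin z).1 = 0 := by
    refine ω.shifted_bijective.1 ?_
    rw [map_zero]
    refine LinearMap.ext fun y => ?_
    have h := LinearMap.congr_fun hz (D.g.lin (D.split.lin y).2)
    conv_lhs at h => rw [← D.f_add_g_split z]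
    rw [map_add, LinearMap.add_apply, shifted_g_g, add_zero] at h
    conv_lhs => rw [← D.f_add_g_split y]
    rw [map_add, shifted_f_f, zero_add, h]
    change η (D.split.lin (D.g.lin _)).1 = 0
    rw [split_g, map_zero]
  refine ⟨(D.split.lin z).2, LinearMap.ext fun a => ?_⟩
  have h := LinearMap.congr_fun hz (D.f.lin a)
  conv_lhs at h => rw [← D.f_add_g_split z, hf, zero_add]
  rw [pairing_apply, h]
  change η (D.split.lin (D.f.lin a)).1 = η a
  rw [split_f]

lemma rightDeriv_toPolyVec_f (a : Lp) (F : Fun G) :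
    CSym.rightDeriv (PolyVec.baseDual n a) (D.toPolyVec F)
      = D.toPolyVec (dirDerivRight (D.f.lin a) F) := by
  rw [toPolyVec_apply, CSym.rightDeriv_map, baseDual_comp_coordInv]
  rfl

lemma leftDeriv_toPolyVec_f (a : Lp) (F : Fun G) :
    CSym.leftDeriv (PolyVec.baseDual n a) (D.toPolyVec F)
      = D.toPolyVec (dirDeriv (D.f.lin a) F) := by
  rw [toPolyVec_apply, CSym.leftDeriv_map, baseDual_comp_coordInv]
  rfl

lemma rightDeriv_toPolyVec_g (b : Lm) (F : Fun G) :
    CSym.rightDeriv (PolyVec.fibreDual n (D.pairing b)) (D.toPolyVec F)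
      = D.toPolyVec (dirDerivRight (D.g.lin b) F) := by
  rw [toPolyVec_apply, CSym.rightDeriv_map, fibreDual_comp_coordInv]
  rfl

lemma leftDeriv_toPolyVec_g (b : Lm) (F : Fun G) :
    CSym.leftDeriv (PolyVec.fibreDual n (D.pairing b)) (D.toPolyVec F)
      = D.toPolyVec (dirDeriv (D.g.lin b) F) := by
  rw [toPolyVec_apply, CSym.leftDeriv_map, fibreDual_comp_coordInv]
  rfl

/-- Graded antisymmetry of `Ω` produces the sign `(-1) ^ ((n + 1)|e_i|)` and the minus sign in the
second half of the Schouten bracket. -/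
lemma shifted_f_sgn (a : Lp) (z : G) :
    ω.shifted (D.f.lin ((Lp.shift 1).sgn (n + 1) a)) z = -D.pairing (D.split.lin z).2 a := by
  have hf : D.f.lin ((Lp.shift 1).sgn (n + 1) a) = (G.shift 1).sgn (n + 1) (D.f.lin a) :=
    map_diag (D.f.shift 1) _ a
  rw [hf, ← neg_neg (ω.shifted _ z), ← ω.shifted_antisymm]
  conv_lhs => rw [← D.f_add_g_split z]
  rw [map_add, LinearMap.add_apply, shifted_f_f, zero_add, pairing_apply]

/-- The resolution of the identity of `𝔤` given by dual bases of `𝔩₊` and `𝔩₋`. -/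
lemma sum_dualBases {κ : Type*} [Fintype κ] (e : Module.Basis κ k Lp) {b : κ → Lm}
    (hb : ∀ i, D.pairing (b i) = e.coord i) (z : G) :
    ∑ j, (Sum.elim (fun i => ω.shifted (D.g.lin (b i)))
        (fun i => (-1 : k) • ω.shifted (D.f.lin ((Lp.shift 1).sgn (n + 1) (e i)))) j :
          Module.Dual k G) z •
      (Sum.elim (fun i => D.f.lin (e i)) (fun i => D.g.lin (b i)) j : G) = z := by
  rw [Fintype.sum_sum_type]
  conv_rhs => rw [← D.f_add_g_split z]
  congr 1
  · simp only [Sum.elim_inl, shifted_g, hb, ← map_smul, ← map_sum]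
    congr 1
    simp
  · simp only [Sum.elim_inr, neg_smul, one_smul, ← map_smul, ← map_sum]
    congr 1
    -- The `𝔩₋`-component is identified by pairing it with the basis `e` of `𝔩₊`.
    refine D.pairing_injective (e.ext fun j => ?_)
    have hz := D.shifted_f_sgn (e j) z
    classical
    simp [hb, hz, Finsupp.single_apply]

/-- The change of coordinates intertwines the Poisson bracket with the Schouten bracket. -/
theorem toPolyVec_bracket (S T : Fun G) :
    D.toPolyVec (ω.bracket S T) = PolyVec.schouten (D.toPolyVec S) (D.toPolyVec T) := by
  choose b hb using fun i => D.pairing_surjective ((Module.finBasis k Lp).coord i)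
  have hmul : ∀ F H : Fun G, D.toPolyVec (F * H) = D.toPolyVec F * D.toPolyVec H :=
    CSym.map_mul D.coordInv
  have h1 : ∀ i, D.toPolyVec (ω.hamiltonian S (ω.shifted (D.g.lin (b i))) *
      dirDeriv (D.f.lin (Module.finBasis k Lp i)) T)
      = CSym.rightDeriv (PolyVec.fibreDual n ((Module.finBasis k Lp).coord i)) (D.toPolyVec S) *
        CSym.leftDeriv (PolyVec.baseDual n (Module.finBasis k Lp i)) (D.toPolyVec T) := fun i => by
    rw [← hb i, rightDeriv_toPolyVec_g, leftDeriv_toPolyVec_f, hmul, ω.hamiltonian_shifted]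
  have h2 : ∀ i, D.toPolyVec (ω.hamiltonian S ((-1 : k) • ω.shifted
        (D.f.lin ((Lp.shift 1).sgn (n + 1) (Module.finBasis k Lp i)))) *
      dirDeriv (D.g.lin (b i)) T)
      = (-1 : k) • (CSym.rightDeriv (PolyVec.baseDual (L := Lp) n
          ((Lp.shift 1).sgn (n + 1) (Module.finBasis k Lp i))) (D.toPolyVec S) *
        CSym.leftDeriv (PolyVec.fibreDual n ((Module.finBasis k Lp).coord i)) (D.toPolyVec T)) :=
    fun i => by
      rw [← hb i, rightDeriv_toPolyVec_f, leftDeriv_toPolyVec_g, hmul, map_smul, map_smul,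
        ω.hamiltonian_shifted, smul_mul_assoc]
  -- In the dual bases, the coordinates `Ω(b_i, ·)` give the first half of the Schouten bracket by
  -- `h1`, and the coordinates `-Ω(± e_i, ·)` give the second half by `h2`.
  rw [ShiftedSymplectic.bracket,
    VectorField.act_eq_sum _ T _ _ (D.sum_dualBases (Module.finBasis k Lp) hb),
    Fintype.sum_sum_type, map_add, map_sum, map_sum, PolyVec.schouten]
  simp only [Sum.elim_inl, Sum.elim_inr]
  refine (congrArg₂ (· + ·) (Finset.sum_congr rfl fun i _ => h1 i)
    (Finset.sum_congr rfl fun i _ => h2 i)).trans ?_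
  rw [← Finset.sum_add_distrib]
  exact Finset.sum_congr rfl fun i _ => CSym.add_neg_one_smul _ _

/-- Setting the fibre coordinates to zero is restriction to `L₊`: the base component of a functional
`φ` on `𝔤` is `φ ∘ f`. -/
lemma restrict_toPolyVec (F : Fun G) :
    PolyVec.restrict n Lp (D.toPolyVec F) = pullback D.f F := by
  refine CSym.map_map_of_eq _ _ _ (fun φ => ?_) F
  obtain ⟨⟨ξ, a⟩, rfl⟩ := D.coordHom_bijective.2 φ
  refine (congrArg Prod.fst (D.coordInv_coordHom (ξ, a))).trans (LinearMap.ext fun c => ?_)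
  change ξ c = (D.coordHom.lin (ξ, a) : Module.Dual k G) (D.f.lin c)
  rw [coordHom_apply, split_f]
  simp

/-- The action functional vanishes on the Lagrangian. -/
lemma pullback_eq_zero [CharZero k] {S : Fun G} (hS : CSym.IsHomog (n + 1) S)
    (hS₀ : CSym.coeff 0 S = 0) {Qp : VectorField Lp}
    (hf : IsStrictMap D.f Qp (ω.hamiltonian S)) : pullback D.f S = 0 := by
  have hR : ∀ a : Lp, dirDerivRight a (pullback D.f S) = 0 := fun a => by
    have h := hf.pullback_apply (ω.shifted (D.f.lin a))
    rw [ω.hamiltonian_shifted] at h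
    -- Isotropy: the coordinate on which `Q` takes the value `S ∂_a` vanishes on `𝔩₊`.
    have h0 : ω.shifted (D.f.lin a) ∘ₗ D.f.lin = 0 := LinearMap.ext fun c => D.shifted_f_f a c
    rw [h0, map_zero] at h
    rw [← h]
    exact CSym.rightDeriv_map _ _ _
  obtain ⟨m, b, d, hb⟩ := Lp.exists_homogeneous_basis_shift 1
  have hP : CSym.IsHomog (n + 1) (pullback D.f S) := hS.map _
  refine CSym.eq_zero_of_euler_eq_zero ?_ ?_
  · refine (CSym.euler_eq_sum (Lp.shift 1) b hb (pullback D.f S)).trans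
      (Finset.sum_eq_zero fun i _ => ?_)
    have h : CSym.rightDeriv (A := (Lp.shift 1).dual) (Module.Dual.eval k (Lp.shift 1) (b i))
      (pullback D.f S) = 0 := hR (b i)
    rw [CSym.IsHomog.leftDeriv_eq (eval_mem_gr (A := Lp.shift 1) (hb i)) hP, h, smul_zero,
      mul_zero]
  · rw [pullback, CSym.coeff_map, hS₀, map_zero]

/-- The fibre derivative dual to `e_i` is the derivative along some `b` in `𝔩₋`. Here `S ∂_b` is `Q
(Ω(b, ·))`, which strictness restricts to `Qp` of the coordinate of `e_i`. -/
lemma component_one_toPolyVec {S : Fun G} {Qp : VectorField Lp}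
    (hf : IsStrictMap D.f Qp (ω.hamiltonian S)) :
    PolyVec.component 1 (D.toPolyVec S) = PolyVec.ofVectorField n Qp := by
  rw [PolyVec.component_one, PolyVec.ofVectorField]
  refine Finset.sum_congr rfl fun i _ => ?_
  rw [PolyVec.linearTerm, LinearMap.mk₂_apply]
  obtain ⟨b, hb⟩ := D.pairing_surjective ((Module.finBasis k Lp).coord i)
  have h := hf.pullback_apply (ω.shifted (D.g.lin b))
  have h0 : ω.shifted (D.g.lin b) ∘ₗ D.f.lin = (Module.finBasis k Lp).coord i := hb
  rw [h0, ω.hamiltonian_shifted] at h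
  rw [← hb, rightDeriv_toPolyVec_g, restrict_toPolyVec, h, hb]

end LagrangianSplitting

end

/-! ### The theorem. -/

theorem mainTheorem4 {k : Type u} [Field k] [CharZero k] {n : ℤ}
    {G : GrSpace.{u, v} k} {Lp : GrSpace.{u, w} k} {Lm : GrSpace.{u, x} k}
    (ω : ShiftedSymplectic G n)
    -- the `L_∞` structure on `𝔤`, given by the action functional `S`
    (Q : VectorField G) (hQ : Q.IsLInfinity)
    (S : Fun G) (hS : CSym.IsHomog (n + 1) S)
    (hS₀ : CSym.coeff 0 S = 0) (hS₁ : CSym.coeff 1 S = 0)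
    (hQS : Q = ω.hamiltonian S)
    -- the regular embedded Lagrangian and the complement
    (Qp : VectorField Lp) (hQp : Qp.IsLInfinity)
    (D : LagrangianSplitting ω Lp Lm) (hf : IsStrictMap D.f Qp Q) :
    -- the pieces of `S` are polyvector fields of degree `j` on `L₊`
    (∀ j, PolyVec.IsPolyDegree j (PolyVec.component j (D.toPolyVec S)) ∧
      CSym.IsHomog (n + 1) (PolyVec.component j (D.toPolyVec S))) ∧
    PolyVec.component 0 (D.toPolyVec S) = 0 ∧
    PolyVec.component 1 (D.toPolyVec S) = PolyVec.ofVectorField n Qp ∧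
    D.toPolyVec S = PolyVec.ofVectorField n Qp +
      PolyVec.tower (fun j => PolyVec.component j (D.toPolyVec S)) ∧
    PolyVec.IsHomotopyPoisson Qp (fun j => PolyVec.component j (D.toPolyVec S)) ∧
    -- the classical master equation is the homotopy Poisson equation
    (∀ T : Fun G, CSym.IsHomog (n + 1) T →
      (ω.bracket T T = 0 ↔ PolyVec.schouten (D.toPolyVec T) (D.toPolyVec T) = 0)) := by
  subst hQS
  have hP : CSym.IsHomog (n + 1) (D.toPolyVec S) := hS.map _
  have h0 : PolyVec.component 0 (D.toPolyVec S) = 0 := by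
    rw [PolyVec.component_zero, D.restrict_toPolyVec, D.pullback_eq_zero hS hS₀ hf, map_zero]
  have h1 := D.component_one_toPolyVec hf
  have h2 := PolyVec.eq_components_add_tower (D.toPolyVec S)
  rw [h0, h1, zero_add] at h2
  refine ⟨fun j => ⟨PolyVec.isPolyDegree_component j _, PolyVec.isHomog_component hP j⟩, h0, h1, h2,
    ⟨fun j _ => PolyVec.isPolyDegree_component j _, fun j _ => PolyVec.isHomog_component hP j, ?_⟩,
    fun T _ => ?_⟩
  -- By `h2` the sum of `Q_{𝔩₊}` and the tower is `Φ(S)`, so its Schouten square is `Φ({S, S})`.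
  · rw [← h2, ← D.toPolyVec_bracket, ω.bracket_self_eq_zero hS hS₁ hQ, map_zero]
  · rw [← D.toPolyVec_bracket]
    exact (map_eq_zero_iff _ D.toPolyVec_injective).symm
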